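/- Let $\mathbb F_q$ be a finite field of odd characteristic $p$ and put $\omega(a)=e^{2\pi i\,\mathrm{Tr}(a)/p}$, where $\mathrm{Tr}:\mathbb F_q\to\mathbb F_p$ is the trace. Let $X$ be an $\mathbb F_q$-vector space of dimension $n$, and let $V=X\oplus X^*$ carry the symplectic form $[x\oplus y,x'\oplus y']=y'(x)-y(x')$. Let $U$ be an $\mathbb F_q$-vector space of dimension $t$ with a non-degenerate symmetric bilinear form $\beta$. Then $U\otimes V\cong \mathrm{Hom}(X,U)^*\oplus\mathrm{Hom}(X,U)$ is again symplectic, and $\mu_{U\otimes V}$ denotes the oscillator (Weil) representation of $\mathrm{Sp}(U\otimes V)$ with character $\omega$ on the space $L^2(\mathrm{Hom}(X,U))$ of complex functions on $\mathrm{Hom}(X,U)$, restricted to $\mathrm{Sp}(V)$ along $g\mapsto 1\otimes g$. For a symmetric map $A:X^*\to X$ let $N_A\in\mathrm{Sp}(V)$ be the element $x\oplus y\mapsto (x+Ay)\oplus y$. A symmetric map $B:X\to X^*$ is a weight of a representation $\rho$ of $\mathrm{Sp}(V)$ if there is a vector $\Phi\ne 0$ with $\rho(N_A)\Phi=\omega(\mathrm{tr}\,AB)\,\Phi$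 for all symmetric $A$. The rank of $\rho$ is the maximum of $\mathrm{rank}\,B$ over its weights $B$. For a subspace $N\subset U$ that is isotropic, i.e. $N\subset N^\perp$, the tensor power CSS code $C_N$ is the space of all $\Phi\in L^2(\mathrm{Hom}(X,U))$ that are supported on $\mathrm{Hom}(X,N^\perp)$ and satisfy $\Phi(F)=\Phi(F')$ whenever $F-F'\in\mathrm{Hom}(X,N)$. Theorem. Assume that $t\le n$, and let $\mathcal K$ be a non-zero $\mathrm{Sp}(V)$-subrepresentation of $\mu_{U\otimes V}$, of rank $r$. Then $r\le t$, the number $t-r$ is even, and $\mathcal K$ is contained in the span of all tensor power CSS codes $C_N$ with $N\subset U$ isotropic and $\dim N=(t-r)/2$. -/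

import Mathlib

open scoped TensorProduct
open Module

namespace Oscillator

section Weyl

variable {k E : Type*} [Field k] [AddCommGroup E] [Module k E]

/-- The symplectic form `[(p, e), (p', e')] = p e' - p' e` on phase space `E* ⊕ E`. -/
def phaseForm (k E : Type*) [Field k] [AddCommGroup E] [Module k E] :
    LinearMap.BilinForm k (Dual k E × E) :=
  LinearMap.mk₂ k (fun v w => v.1 w.2 - w.1 v.2)
    (by intros; simp; ring) (by intros; simp; ring) (by intros; simp; ring)
    (by intros; simp; ring)

/-- The group of linear automorphisms of `W` that preserve the bilinear form `B`. -/
def isometryGroup {W : Type*} [AddCommGroup W] [Module k W] (B : LinearMap.BilinForm k W) :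
    Subgroup (W ≃ₗ[k] W) where
  carrier := {g | ∀ v w, B (g v) (g w) = B v w}
  mul_mem' {a b} ha hb v w := by
    rw [LinearEquiv.mul_apply, LinearEquiv.mul_apply, ha, hb]
  one_mem' _ _ := rfl
  inv_mem' {a} ha v w := by
    rw [← ha, ← LinearEquiv.mul_apply, ← LinearEquiv.mul_apply, mul_inv_cancel]
    rfl

/-- The Weyl operator `W(p, e)` on functions on `E`: it sends `δ_z` to
`ψ(p z + p e / 2) δ_{z + e}`. These operators satisfy `W(v) W(w) = ψ([v, w] / 2) W(v + w)`,
see `weyl_mul`. -/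
def weyl (ψ : AddChar k ℂ) (v : Dual k E × E) : End ℂ (E → ℂ) where
  toFun f z := ψ (v.1 z - 2⁻¹ * v.1 v.2) * f (z - v.2)
  map_add' f g := by ext z; simp [mul_add]
  map_smul' c f := by ext z; simp [mul_left_comm]

/-- The parity operator `(R f)(z) = f(-z)`. -/
def parity (E : Type*) [AddCommGroup E] : End ℂ (E → ℂ) where
  toFun f z := f (-z)
  map_add' _ _ := rfl
  map_smul' _ _ := rfl

/-- The projection onto the even functions. -/
noncomputable def evenProj (E : Type*) [AddCommGroup E] : End ℂ (E → ℂ) :=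
  (2⁻¹ : ℂ) • (1 + parity E)

/-- The projection onto the odd functions. -/
noncomputable def oddProj (E : Type*) [AddCommGroup E] : End ℂ (E → ℂ) :=
  (2⁻¹ : ℂ) • (1 - parity E)

/-- For an operator `T` that commutes with parity, the determinant of the restriction of `T` to
the even functions (`T` is extended by the identity on the odd functions). -/
noncomputable def detEven (T : End ℂ (E → ℂ)) : ℂ :=
  LinearMap.det (T * evenProj E + oddProj E)

/-- For an operator `T` that commutes with parity, the determinant of the restriction of `T` to
the odd functions (`T` is extended by the identity on the even functions). -/
noncomputable def detOdd (T : End ℂ (E → ℂ)) : ℂ :=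
  LinearMap.det (T * oddProj E + evenProj E)

/-- `T` is the operator by which `g ∈ Sp(E* ⊕ E)` acts in the oscillator representation: it
implements `g` on the Weyl operators, `T W(v) T⁻¹ = W(g v)`, which determines `T` up to a scalar,
and the scalar is fixed by requiring that `T` has the same determinant on the even as on the odd
functions. There is exactly one such `T` (`existsUnique_isOscillator`), and it is multiplicative
in `g`. On the usual generators one gets, with `q` the number of elements of `k`:
* for `(p, e) ↦ (p + A e, e)` with `A : E → E*` symmetric, `T δ_z = ψ(A(z, z) / 2) δ_z`
  (`oscillator_shear`);
* for `(p, e) ↦ (p ∘ C⁻¹, C e)` with `C ∈ GL(E)`, `T δ_z = (det C / q) δ_{C z}`, with the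
  quadratic character of `k`;
* for `(p, e) ↦ (B e, - B⁻¹ p)` with `B : E → E*` symmetric and invertible,
  `T δ_z = γ⁻¹ ∑_{z'} ψ(B(z, z')) δ_{z'}`, with the Gauss sum `γ = ∑_z ψ(- B(z, z) / 2)`. -/
structure IsOscillator (ψ : AddChar k ℂ) (g : isometryGroup (phaseForm k E))
    (T : End ℂ (E → ℂ)) : Prop where
  ne_zero : T ≠ 0
  intertwines : ∀ v, T * weyl ψ v = weyl ψ (g.1 v) * T
  det_eq : detEven T = detOdd T

lemma phaseForm_apply (v w : Dual k E × E) : phaseForm k E v w = v.1 w.2 - w.1 v.2 := rfl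

lemma weyl_apply (ψ : AddChar k ℂ) (v : Dual k E × E) (f : E → ℂ) (z : E) :
    weyl ψ v f z = ψ (v.1 z - 2⁻¹ * v.1 v.2) * f (z - v.2) := rfl

lemma weyl_zero (ψ : AddChar k ℂ) : weyl ψ (0 : Dual k E × E) = 1 := by
  ext f z; simp [weyl_apply]

lemma weyl_mul (ψ : AddChar k ℂ) (h2 : (2 : k) ≠ 0) (v w : Dual k E × E) :
    weyl ψ v * weyl ψ w = ψ (2⁻¹ * phaseForm k E v w) • weyl ψ (v + w) := by
  refine LinearMap.ext fun f => funext fun z => ?_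
  simp only [Module.End.mul_apply, weyl_apply, LinearMap.smul_apply, Pi.smul_apply, smul_eq_mul,
    phaseForm_apply, ← mul_assoc, ← AddChar.map_add_eq_mul, Prod.fst_add, Prod.snd_add, sub_sub,
    LinearMap.add_apply, map_add, map_sub]
  congr 2
  field_simp
  ring

lemma parity_mul_weyl (ψ : AddChar k ℂ) (v : Dual k E × E) :
    parity E * weyl ψ v = weyl ψ (-v) * parity E := by
  refine LinearMap.ext fun f => funext fun z => ?_
  simp [parity, weyl_apply, Module.End.mul_apply, sub_eq_add_neg, add_comm]

lemma parity_mul_self : parity E * parity E = 1 := by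
  refine LinearMap.ext fun f => funext fun z => ?_
  simp [parity, Module.End.mul_apply]

lemma evenProj_mul_self : evenProj E * evenProj E = evenProj E := by
  simp only [evenProj, smul_mul_smul_comm, mul_add, add_mul, parity_mul_self, mul_one, one_mul]
  module

lemma oddProj_mul_self : oddProj E * oddProj E = oddProj E := by
  simp only [oddProj, smul_mul_smul_comm, mul_sub, sub_mul, parity_mul_self, mul_one, one_mul]
  module

lemma evenProj_mul_oddProj : evenProj E * oddProj E = 0 := by
  simp only [oddProj, evenProj, smul_mul_smul_comm, mul_sub, add_mul, parity_mul_self, mul_one,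
    one_mul]
  module

lemma oddProj_mul_evenProj : oddProj E * evenProj E = 0 := by
  simp only [oddProj, evenProj, smul_mul_smul_comm, mul_add, sub_mul, parity_mul_self, mul_one,
    one_mul]
  module

lemma evenProj_add_oddProj : evenProj E + oddProj E = 1 := by
  simp only [oddProj, evenProj]
  module

section det

variable {T S : End ℂ (E → ℂ)}

lemma commute_evenProj (h : Commute T (parity E)) : Commute T (evenProj E) :=
  ((Commute.one_right _).add_right h).smul_right _

lemma commute_oddProj (h : Commute T (parity E)) : Commute T (oddProj E) :=
  ((Commute.one_right _).sub_right h).smul_right _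

lemma detEven_mul (hS : Commute S (parity E)) :
    detEven (T * S) = detEven T * detEven S := by
  rw [detEven, detEven, detEven, ← map_mul]
  congr 1
  have h1 := commute_evenProj hS
  have h2 := commute_oddProj hS
  have e1 : T * evenProj E * (S * evenProj E) = T * S * evenProj E := by
    rw [h1.eq, mul_assoc, ← mul_assoc (evenProj E), evenProj_mul_self, ← h1.eq, mul_assoc]
  have e2 : oddProj E * (S * evenProj E) = 0 := by
    rw [h1.eq, ← mul_assoc, oddProj_mul_evenProj, zero_mul]
  rw [mul_add, add_mul, add_mul, e1, e2, mul_assoc T (evenProj E), evenProj_mul_oddProj,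
    oddProj_mul_self]
  simp

lemma detOdd_mul (hS : Commute S (parity E)) :
    detOdd (T * S) = detOdd T * detOdd S := by
  rw [detOdd, detOdd, detOdd, ← map_mul]
  congr 1
  have h1 := commute_oddProj hS
  have e1 : T * oddProj E * (S * oddProj E) = T * S * oddProj E := by
    rw [h1.eq, mul_assoc, ← mul_assoc (oddProj E), oddProj_mul_self, ← h1.eq, mul_assoc]
  have e2 : evenProj E * (S * oddProj E) = 0 := by
    rw [h1.eq, ← mul_assoc, evenProj_mul_oddProj, zero_mul]
  rw [mul_add, add_mul, add_mul, e1, e2, mul_assoc T (oddProj E), oddProj_mul_evenProj,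
    evenProj_mul_self]
  simp

lemma detEven_one : detEven (1 : End ℂ (E → ℂ)) = 1 := by
  rw [detEven, one_mul, evenProj_add_oddProj, map_one]

lemma detOdd_one : detOdd (1 : End ℂ (E → ℂ)) = 1 := by
  rw [detOdd, one_mul, add_comm, evenProj_add_oddProj, map_one]

lemma det_smul_proj {M : Type*} [AddCommGroup M] [Module ℂ M] [FiniteDimensional ℂ M]
    {P Q : End ℂ M} (hP : P * P = P) (hPQ : P + Q = 1) (c : ℂ) :
    LinearMap.det (c • P + Q) = c ^ finrank ℂ (LinearMap.range P) := by
  have hQ : Q = 1 - P := by rw [← hPQ]; simp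
  have hi : IsIdempotentElem P := hP
  have hp := LinearMap.IsIdempotentElem.isProj_range P hi
  have h1 : c • P + Q = 1 + (c - 1) • P := by rw [hQ]; module
  rw [h1]
  have h3 : (1 : End ℂ M) + (c - 1) • P =
      ((LinearMap.range P).prodEquivOfIsCompl _ hp.isCompl).conj
        (LinearMap.prodMap (c • LinearMap.id) LinearMap.id) := by
    conv_lhs => rw [hp.eq_conj_prodMap, ← map_smul]
    have : (1 : End ℂ M) = ((LinearMap.range P).prodEquivOfIsCompl _ hp.isCompl).conj
        LinearMap.id := by
      rw [LinearEquiv.conj_id]; rfl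
    rw [this, ← map_add]
    congr 1
    ext <;> simp
    module
  rw [h3, LinearEquiv.conj_apply, LinearMap.comp_assoc, LinearMap.det_conj,
    LinearMap.det_prodMap]
  simp

variable [Finite E]

lemma trace_parity (h2 : ∀ z : E, -z = z → z = 0) :
    LinearMap.trace ℂ (E → ℂ) (parity E) = 1 := by
  classical
  have := Fintype.ofFinite E
  rw [LinearMap.trace_eq_matrix_trace ℂ (Pi.basisFun ℂ E), Matrix.trace]
  have : ∀ z : E, (LinearMap.toMatrix (Pi.basisFun ℂ E) (Pi.basisFun ℂ E) (parity E)).diag z =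
      if z = 0 then 1 else 0 := by
    intro z
    simp only [Matrix.diag_apply, LinearMap.toMatrix_apply, Pi.basisFun_apply, Pi.basisFun_repr,
      parity, LinearMap.coe_mk, AddHom.coe_mk, Pi.single_apply]
    by_cases h : z = 0
    · simp [h]
    · rw [if_neg h, if_neg fun h' => h (h2 z h')]
  rw [Finset.sum_congr rfl fun z _ => this z]
  simp

lemma finrank_even (h2 : ∀ z : E, -z = z → z = 0) :
    finrank ℂ (LinearMap.range (evenProj E)) = finrank ℂ (LinearMap.range (oddProj E)) + 1 := by
  have a := (LinearMap.IsIdempotentElem.isProj_range (evenProj E) evenProj_mul_self).trace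
  have b := (LinearMap.IsIdempotentElem.isProj_range (oddProj E) oddProj_mul_self).trace
  have c : evenProj E = oddProj E + parity E := by
    simp only [evenProj, oddProj]; module
  rw [c, map_add, trace_parity h2, b, ← c] at a
  exact_mod_cast a.symm

lemma detEven_smul (h2 : ∀ z : E, -z = z → z = 0) :
    ∃ d : ℕ, ∀ (c : ℂ) (T : End ℂ (E → ℂ)),
      detEven (c • T) = c ^ (d + 1) * detEven T ∧ detOdd (c • T) = c ^ d * detOdd T := by
  have hc (c : ℂ) : Commute (c • (1 : End ℂ (E → ℂ))) (parity E) :=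
    (Commute.one_left _).smul_left c
  refine ⟨finrank ℂ (LinearMap.range (oddProj E)), fun c T => ⟨?_, ?_⟩⟩
  · have : c • T = T * (c • 1) := by simp
    rw [this, detEven_mul (hc c), mul_comm, detEven, smul_mul_assoc, one_mul,
      det_smul_proj evenProj_mul_self evenProj_add_oddProj, finrank_even h2]
  · have : c • T = T * (c • 1) := by simp
    rw [this, detOdd_mul (hc c), mul_comm, detOdd, smul_mul_assoc, one_mul,
      det_smul_proj oddProj_mul_self ((add_comm _ _).trans evenProj_add_oddProj)]

end det

section Construction

variable {ψ : AddChar k ℂ}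

/-- Modulations separate points. -/
lemma exists_char_ne_one (hψ : ψ ≠ 1) {z : E} (hz : z ≠ 0) : ∃ p : Dual k E, ψ (p z) ≠ 1 := by
  obtain ⟨a, ha⟩ := AddChar.ne_one_iff.1 hψ
  obtain ⟨p, hp⟩ : ∃ p : Dual k E, p z ≠ 0 := by
    by_contra! h
    exact hz ((Module.forall_dual_apply_eq_zero_iff k z).1 h)
  refine ⟨(a * (p z)⁻¹) • p, ?_⟩
  simpa [mul_assoc, hp] using ha

lemma weyl_single [DecidableEq E] (v : Dual k E × E) (z : E) :
    weyl ψ v (Pi.single z 1) =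
      ψ (v.1 z + (1 - 2⁻¹) * v.1 v.2) • Pi.single (z + v.2) (1 : ℂ) := by
  ext y
  simp only [weyl_apply, Pi.single_apply, Pi.smul_apply, smul_eq_mul, sub_eq_iff_eq_add]
  split_ifs with h
  · rw [h, map_add]; congr 2; ring
  · simp

lemma eq_smul_one_of_commute [Finite E] (hψ : ψ ≠ 1) (S : End ℂ (E → ℂ))
    (hS : ∀ v : Dual k E × E, S * weyl ψ v = weyl ψ v * S) : ∃ c : ℂ, S = c • 1 := by
  classical
  have := Fintype.ofFinite E
  have hS' (v : Dual k E × E) (f : E → ℂ) : S (weyl ψ v f) = weyl ψ v (S f) :=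
    congrArg (fun T : End ℂ (E → ℂ) => T f) (hS v)
  set f := S (Pi.single 0 1) with hf
  have h0 : f = f 0 • Pi.single (0 : E) (1 : ℂ) := by
    ext z
    by_cases hz : z = 0
    · simp [hz]
    · obtain ⟨p, hp⟩ := exists_char_ne_one (k := k) hψ hz
      have h1 : weyl ψ (p, (0 : E)) (Pi.single 0 1) = Pi.single (0 : E) (1 : ℂ) := by
        rw [weyl_single]; simp
      have h2 := congrFun (hS' (p, 0) (Pi.single 0 1)) z
      rw [h1, ← hf, weyl_apply] at h2
      simp only [map_zero, mul_zero, sub_zero] at h2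
      have h3 : (ψ (p z) - 1) * f z = 0 := by rw [sub_mul, ← h2]; ring
      rcases mul_eq_zero.1 h3 with h | h
      · exact absurd (sub_eq_zero.1 h) hp
      · simp [h, hz]
  refine ⟨f 0, ?_⟩
  refine (Pi.basisFun ℂ E).ext fun e => ?_
  have h1 : weyl ψ ((0 : Dual k E), e) (Pi.single 0 1) = Pi.single e (1 : ℂ) := by
    rw [weyl_single]; simp
  have h2 := hS' (0, e) (Pi.single 0 1)
  rw [h1, ← hf, h0, map_smul, h1] at h2
  simpa using h2

lemma sum_char_dual [Fintype (Dual k E)] (hψ : ψ ≠ 1) {z : E} (hz : z ≠ 0) :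
    ∑ p : Dual k E, ψ (p z) = 0 := by
  let χ : AddChar (Dual k E) ℂ := ψ.compAddMonoidHom (Dual.eval k E z).toAddMonoidHom
  have : χ ≠ 1 := by
    obtain ⟨p, hp⟩ := exists_char_ne_one (k := k) hψ hz
    exact AddChar.ne_one_iff.2 ⟨p, hp⟩
  exact AddChar.sum_eq_zero_of_ne_one this

lemma sum_char [Fintype E] (hψ : ψ ≠ 1) {p : Dual k E} (hp : p ≠ 0) :
    ∑ z : E, ψ (p z) = 0 := by
  let χ : AddChar E ℂ := ψ.compAddMonoidHom p.toAddMonoidHom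
  have : χ ≠ 1 := by
    obtain ⟨z, hz⟩ : ∃ z, p z ≠ 0 := by
      by_contra! h
      exact hp (LinearMap.ext h)
    obtain ⟨a, ha⟩ := AddChar.ne_one_iff.1 hψ
    refine AddChar.ne_one_iff.2 ⟨(a * (p z)⁻¹) • z, ?_⟩
    simpa [χ, mul_assoc, hz] using ha
  exact AddChar.sum_eq_zero_of_ne_one this

lemma exists_inverse {E : Type*} [Finite E] {T : End ℂ (E → ℂ)} (hT : Function.Injective T) :
    ∃ S : End ℂ (E → ℂ), S * T = 1 ∧ T * S = 1 := by
  have := Fintype.ofFinite E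
  let e := LinearEquiv.ofInjectiveEndo T hT
  exact ⟨e.symm, LinearMap.ext fun f => e.symm_apply_apply f,
    LinearMap.ext fun f => e.apply_symm_apply f⟩

lemma neg_eq_self_imp (h2 : (2 : k) ≠ 0) (z : E) (h : -z = z) : z = 0 := by
  have : (2 : k) • z = 0 := by rw [two_smul]; nth_rewrite 1 [← h]; simp
  exact (smul_eq_zero.1 this).resolve_left h2

lemma detEven_ne_zero {T R : End ℂ (E → ℂ)} (hR : Commute R (parity E)) (h : T * R = 1) :
    detEven T ≠ 0 ∧ detOdd T ≠ 0 := by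
  have h1 := detEven_mul (T := T) hR
  have h2 := detOdd_mul (T := T) hR
  rw [h, detEven_one] at h1
  rw [h, detOdd_one] at h2
  exact ⟨left_ne_zero_of_mul_eq_one h1.symm, left_ne_zero_of_mul_eq_one h2.symm⟩

variable [Finite k] [FiniteDimensional k E]

lemma finite_dual : Finite (Dual k E) := Module.finite_of_finite k

/-- A nonzero operator that intertwines the Weyl operators along some map is injective. -/
lemma injective_of_intertwines (hψ : ψ ≠ 1) {g : Dual k E × E → Dual k E × E}
    {T : End ℂ (E → ℂ)} (hT : T ≠ 0) (h : ∀ v, T * weyl ψ v = weyl ψ (g v) * T) :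
    Function.Injective T := by
  classical
  have := finite_dual (k := k) (E := E)
  have := Fintype.ofFinite (Dual k E)
  have : Finite E := Module.finite_of_finite k
  have := Fintype.ofFinite E
  have hW (v : Dual k E × E) {f : E → ℂ} (hf : T f = 0) : T (weyl ψ v f) = 0 := by
    have := congrArg (fun S : End ℂ (E → ℂ) => S f) (h v)
    simpa [Module.End.mul_apply, hf] using this
  rw [← LinearMap.ker_eq_bot, LinearMap.ker_eq_bot']
  intro f hf
  by_contra hne
  obtain ⟨z₀, hz₀⟩ : ∃ z, f z ≠ 0 := by
    by_contra! h'
    exact hne (funext h')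
  have h1 : T (∑ p : Dual k E, ψ (-(p z₀)) • weyl ψ (p, (0 : E)) f) = 0 := by
    rw [map_sum]
    exact Finset.sum_eq_zero fun p _ => by rw [map_smul, hW _ hf, smul_zero]
  have h2 : ∑ p : Dual k E, ψ (-(p z₀)) • weyl ψ (p, (0 : E)) f =
      (Fintype.card (Dual k E) * f z₀ : ℂ) • Pi.single z₀ (1 : ℂ) := by
    ext z
    simp only [Finset.sum_apply, Pi.smul_apply, weyl_apply, smul_eq_mul, ← mul_assoc,
      ← AddChar.map_add_eq_mul, map_zero, mul_zero, sub_zero, ← Finset.sum_mul]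
    by_cases hz : z = z₀
    · subst hz; simp
    · have : ∀ p : Dual k E, ψ (-(p z₀) + p z) = ψ (p (z - z₀)) := fun p => by
        rw [map_sub]; congr 1; ring
      simp only [this, sum_char_dual hψ (sub_ne_zero.2 hz)]
      simp [hz]
  have h3 : T (Pi.single z₀ 1) = 0 := by
    rw [h2, map_smul] at h1
    refine (smul_eq_zero.1 h1).resolve_left (mul_ne_zero ?_ hz₀)
    exact_mod_cast Fintype.card_ne_zero
  refine hT ((Pi.basisFun ℂ E).ext fun e => ?_)
  have h4 := hW (0, e - z₀) h3
  rw [weyl_single] at h4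
  simpa using h4

lemma exists_intertwiner (hψ : ψ ≠ 1) (h2 : (2 : k) ≠ 0) (g : isometryGroup (phaseForm k E)) :
    ∃ T : End ℂ (E → ℂ), T ≠ 0 ∧ ∀ v, T * weyl ψ v = weyl ψ (g.1 v) * T := by
  classical
  have := finite_dual (k := k) (E := E)
  have := Fintype.ofFinite (Dual k E)
  have : Finite E := Module.finite_of_finite k
  have := Fintype.ofFinite E
  let A (a : E) : End ℂ (E → ℂ) := (LinearMap.proj 0).smulRight (Pi.single a (1 : ℂ))
  let T (a : E) : End ℂ (E → ℂ) :=
    ∑ v : Dual k E × E, weyl ψ (g.1 v) * A a * weyl ψ (-v)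
  have hT (a : E) (w : Dual k E × E) : T a * weyl ψ w = weyl ψ (g.1 w) * T a := by
    simp only [T, Finset.sum_mul, Finset.mul_sum]
    refine (Fintype.sum_equiv (Equiv.addRight w) _ _ fun v => ?_).symm
    have hg := g.2 w v
    have e1 : weyl ψ (g.1 w) * (weyl ψ (g.1 v) * A a * weyl ψ (-v)) =
        (weyl ψ (g.1 w) * weyl ψ (g.1 v)) * A a * weyl ψ (-v) := by
      simp only [mul_assoc]
    have e2 : weyl ψ (g.1 (v + w)) * A a * weyl ψ (-(v + w)) * weyl ψ w =
        weyl ψ (g.1 (v + w)) * A a * (weyl ψ (-(v + w)) * weyl ψ w) := by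
      simp only [mul_assoc]
    simp only [Equiv.coe_addRight]
    rw [e1, e2, weyl_mul ψ h2, weyl_mul ψ h2, hg]
    have e3 : phaseForm k E (-(v + w)) w = phaseForm k E w v := by
      simp only [phaseForm_apply, map_neg, map_add, LinearMap.neg_apply, LinearMap.add_apply]
      ring
    rw [e3, show -(v + w) + w = -v by abel, map_add, add_comm (g.1 w)]
    simp only [smul_mul_assoc, mul_smul_comm]
  by_contra! hcon
  have hT0 (a : E) : T a = 0 := by
    by_contra h
    obtain ⟨v, hv⟩ := hcon (T a) h
    exact hv (hT a v)
  have key : ∑ a : E, T a (Pi.single 0 1) a = (Fintype.card E : ℂ) := by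
    have h1 (a : E) : T a (Pi.single 0 1) a =
        ∑ v : Dual k E × E, if v.2 = 0 then weyl ψ (g.1 v) (Pi.single a 1) a else 0 := by
      simp only [T, LinearMap.sum_apply, Finset.sum_apply]
      refine Finset.sum_congr rfl fun v _ => ?_
      simp only [Module.End.mul_apply, A, LinearMap.smulRight_apply, LinearMap.proj_apply,
        map_smul, Pi.smul_apply, weyl_single, smul_eq_mul]
      split_ifs with h
      · simp [h]
      · simp [Pi.single_apply, h, eq_comm]
    have h3 (w : Dual k E × E) :
        ∑ a : E, weyl ψ w (Pi.single a 1) a = if w = 0 then (Fintype.card E : ℂ) else 0 := by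
      simp only [weyl_single, Pi.smul_apply, Pi.single_apply, smul_eq_mul]
      by_cases hw : w.2 = 0
      · by_cases hw1 : w.1 = 0
        · have : w = 0 := Prod.ext hw1 hw
          simp [this]
        · have : w ≠ 0 := fun h => hw1 (by rw [h]; rfl)
          simp [hw, this, sum_char hψ hw1]
      · have : w ≠ 0 := fun h => hw (by rw [h]; rfl)
        simp [hw, this]
    simp only [h1]
    rw [Finset.sum_comm, Finset.sum_eq_single 0]
    · simp only [Prod.snd_zero, if_true]
      rw [h3]; simp
    · intro v _ hv
      split_ifs with h
      · rw [h3, if_neg (by simpa using hv)]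
      · simp
    · simp
  simp only [hT0, LinearMap.zero_apply, Pi.zero_apply, Finset.sum_const_zero] at key
  exact Fintype.card_ne_zero (α := E) (by exact_mod_cast key.symm)

/-- Intertwiners are unique up to scalars. -/
lemma intertwiner_unique (hψ : ψ ≠ 1) {g : Dual k E × E → Dual k E × E} {S T : End ℂ (E → ℂ)}
    (hT0 : T ≠ 0) (hT : ∀ v, T * weyl ψ v = weyl ψ (g v) * T)
    (hS : ∀ v, S * weyl ψ v = weyl ψ (g v) * S) : ∃ c : ℂ, S = c • T := by
  have : Finite E := Module.finite_of_finite k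
  obtain ⟨R, hR1, hR2⟩ := exists_inverse (injective_of_intertwines hψ hT0 hT)
  obtain ⟨c, hc⟩ := eq_smul_one_of_commute hψ (R * S) fun v => by
    have : R * weyl ψ (g v) = weyl ψ v * R := by
      calc R * weyl ψ (g v) = R * (weyl ψ (g v) * T) * R := by simp [mul_assoc, hR2]
        _ = (R * T) * (weyl ψ v * R) := by rw [← hT]; simp only [mul_assoc]
        _ = _ := by rw [hR1, one_mul]
    rw [mul_assoc, hS, ← mul_assoc, this, mul_assoc]
  refine ⟨c, ?_⟩
  calc S = T * (R * S) := by rw [← mul_assoc, hR2, one_mul]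
    _ = c • T := by rw [hc]; simp

lemma commute_parity (hψ : ψ ≠ 1) (h2 : (2 : k) ≠ 0) {g : (Dual k E × E) ≃ₗ[k] (Dual k E × E)}
    {T : End ℂ (E → ℂ)} (hT0 : T ≠ 0) (hT : ∀ v, T * weyl ψ v = weyl ψ (g v) * T) :
    Commute T (parity E) := by
  have : Finite E := Module.finite_of_finite k
  obtain ⟨R, hR1, hR2⟩ := exists_inverse (injective_of_intertwines hψ hT0 hT)
  have hz := neg_eq_self_imp (k := k) (E := E) h2
  have hpw (v : Dual k E × E) : parity E * weyl ψ v = weyl ψ (-v) * parity E :=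
    parity_mul_weyl ψ v
  obtain ⟨c, hc⟩ := intertwiner_unique (S := parity E * T * parity E) hψ hT0 hT fun v => by
    rw [mul_assoc, hpw, ← mul_assoc, mul_assoc (parity E), hT, ← mul_assoc, hpw, map_neg, neg_neg]
    simp only [mul_assoc]
  have h1 : T * parity E = c • (parity E * T) := by
    have := congrArg (parity E * ·) hc
    simpa only [← mul_assoc, parity_mul_self, one_mul, mul_smul_comm] using this
  have h3 : R * parity E * T = c⁻¹ • parity E ∨ c = 0 := by
    by_cases hc0 : c = 0
    · exact Or.inr hc0
    · left
      have : R * (T * parity E) = c • (R * parity E * T) := by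
        rw [h1, mul_smul_comm, mul_assoc]
      rw [← mul_assoc, hR1, one_mul] at this
      exact ((congrArg (c⁻¹ • ·) this).trans
        (by simp only [smul_smul, inv_mul_cancel₀ hc0, one_smul])).symm
  rcases h3 with h3 | h3
  · have h4 : LinearMap.trace ℂ (E → ℂ) (R * parity E * T) = 1 := by
      rw [LinearMap.trace_mul_comm, ← mul_assoc, hR2, one_mul, trace_parity hz]
    rw [h3, map_smul, trace_parity hz, smul_eq_mul, mul_one, inv_eq_one] at h4
    rw [h4, one_smul] at h1
    exact h1
  · rw [h3, zero_smul] at h1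
    have : T * (parity E * parity E) = 0 := by rw [← mul_assoc, h1, zero_mul]
    rw [parity_mul_self, mul_one] at this
    exact absurd this hT0

lemma det_ne_zero_of_intertwines (hψ : ψ ≠ 1) (h2 : (2 : k) ≠ 0)
    {g : (Dual k E × E) ≃ₗ[k] (Dual k E × E)}
    {T : End ℂ (E → ℂ)} (hT0 : T ≠ 0) (hT : ∀ v, T * weyl ψ v = weyl ψ (g v) * T) :
    detEven T ≠ 0 ∧ detOdd T ≠ 0 := by
  have : Finite E := Module.finite_of_finite k
  obtain ⟨R, hR1, hR2⟩ := exists_inverse (injective_of_intertwines hψ hT0 hT)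
  have hc := commute_parity hψ h2 hT0 hT
  refine detEven_ne_zero (T := T) (R := R) ?_ hR2
  calc R * parity E = R * (parity E * T) * R := by simp [mul_assoc, hR2]
    _ = parity E * R := by rw [← hc.eq, ← mul_assoc, hR1, one_mul]

theorem existsUnique_isOscillator (hψ : ψ ≠ 1) (h2 : (2 : k) ≠ 0)
    (g : isometryGroup (phaseForm k E)) : ∃! T : End ℂ (E → ℂ), IsOscillator ψ g T := by
  have : Finite E := Module.finite_of_finite k
  obtain ⟨d, hd⟩ := detEven_smul (neg_eq_self_imp (k := k) (E := E) h2)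
  obtain ⟨T, hT0, hT⟩ := exists_intertwiner hψ h2 g
  obtain ⟨he, ho⟩ := det_ne_zero_of_intertwines hψ h2 hT0 hT
  have hc : detOdd T / detEven T ≠ 0 := div_ne_zero ho he
  refine existsUnique_of_exists_of_unique ⟨(detOdd T / detEven T) • T, smul_ne_zero hc hT0,
    fun v => ?_, ?_⟩ ?_
  · rw [smul_mul_assoc, hT, mul_smul_comm]
  · rw [(hd _ _).1, (hd _ _).2]
    rw [pow_succ, mul_assoc, div_mul_cancel₀ _ he]
  · intro S S' hS hS'
    obtain ⟨c, rfl⟩ := intertwiner_unique hψ hS'.ne_zero hS'.intertwines hS.intertwines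
    obtain ⟨he, ho⟩ := det_ne_zero_of_intertwines hψ h2 hS'.ne_zero hS'.intertwines
    have hc0 : c ≠ 0 := fun h => hS.ne_zero (by rw [h, zero_smul])
    have := hS.det_eq
    rw [(hd _ _).1, (hd _ _).2, hS'.det_eq, pow_succ] at this
    have h3 : c = 1 := by
      have h4 := mul_right_cancel₀ ho this
      exact mul_left_cancel₀ (pow_ne_zero d hc0) (h4.trans (mul_one _).symm)
    rw [h3, one_smul]

/-- The oscillator (Weil) representation of `Sp(E* ⊕ E)` on the complex functions on `E`: the
element `g` acts by the unique operator `T` with `IsOscillator ψ g T`. -/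
noncomputable def oscillator (ψ : AddChar k ℂ) (hψ : ψ ≠ 1) (h2 : (2 : k) ≠ 0) :
    Representation ℂ (isometryGroup (phaseForm k E)) (E → ℂ) where
  toFun g := (existsUnique_isOscillator hψ h2 g).choose
  map_one' := ((existsUnique_isOscillator hψ h2 1).choose_spec.2 1
    ⟨by
      intro h
      have := congrFun (congrArg (fun T : End ℂ (E → ℂ) => T 1) h) 0
      simp at this, fun v => by simp, by rw [detEven_one, detOdd_one]⟩).symm
  map_mul' g g' := by
    obtain ⟨T, ⟨hT, -⟩, h1⟩ : ∃ T, (IsOscillator ψ g T ∧ True) ∧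
        (existsUnique_isOscillator hψ h2 g).choose = T :=
      ⟨_, ⟨(existsUnique_isOscillator hψ h2 g).choose_spec.1, trivial⟩, rfl⟩
    obtain ⟨S, ⟨hS, -⟩, h3⟩ : ∃ T, (IsOscillator ψ g' T ∧ True) ∧
        (existsUnique_isOscillator hψ h2 g').choose = T :=
      ⟨_, ⟨(existsUnique_isOscillator hψ h2 g').choose_spec.1, trivial⟩, rfl⟩
    rw [h1, h3]
    have hc := commute_parity hψ h2 hS.ne_zero hS.intertwines
    have : Finite E := Module.finite_of_finite k
    refine ((existsUnique_isOscillator hψ h2 (g * g')).choose_spec.2 (T * S) ⟨?_, ?_, ?_⟩).symm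
    · intro h
      obtain ⟨R, hR1, hR2⟩ := exists_inverse
        (injective_of_intertwines hψ hT.ne_zero hT.intertwines)
      apply hS.ne_zero
      rw [← one_mul S, ← hR1, mul_assoc, h, mul_zero]
    · intro v
      rw [mul_assoc, hS.intertwines, ← mul_assoc, hT.intertwines, mul_assoc]
      rfl
    · rw [detEven_mul hc, detOdd_mul hc, hT.det_eq, hS.det_eq]

lemma oscillator_spec (hψ : ψ ≠ 1) (h2 : (2 : k) ≠ 0) (g : isometryGroup (phaseForm k E)) :
    IsOscillator ψ g (oscillator ψ hψ h2 g) :=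
  (existsUnique_isOscillator hψ h2 g).choose_spec.1

end Construction

/-- The shear `(p, e) ↦ (p + A e, e)` by a symmetric map `A` acts by multiplication with the
function `z ↦ ψ(A(z, z) / 2)`. -/
lemma oscillator_shear {ψ : AddChar k ℂ} [Finite k] [FiniteDimensional k E]
    (hψ : ψ ≠ 1) (h2 : (2 : k) ≠ 0) (g : isometryGroup (phaseForm k E))
    (A : E →ₗ[k] Dual k E) (hA : ∀ e e', A e e' = A e' e)
    (hg : ∀ v, g.1 v = (v.1 + A v.2, v.2)) (f : E → ℂ) (z : E) :
    oscillator ψ hψ h2 g f z = ψ (2⁻¹ * A z z) * f z := by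
  classical
  have : Finite E := Module.finite_of_finite k
  let d : E → ℂ := fun z => ψ (2⁻¹ * A z z)
  let mulOp : (E → ℂ) → End ℂ (E → ℂ) := fun h => LinearMap.mulLeft ℂ h
  have hd0 : d 0 = 1 := by simp [d]
  have hdneg (z : E) : d (-z) = d z := by simp [d]
  have hD : IsOscillator ψ g (mulOp d) := by
    refine ⟨fun h => ?_, fun v => ?_, ?_⟩
    · have := congrFun (congrArg (fun T : End ℂ (E → ℂ) => T 1) h) 0
      simp [mulOp, hd0] at this
    · refine LinearMap.ext fun f => funext fun z => ?_
      simp only [hg, Module.End.mul_apply, mulOp, LinearMap.mulLeft_apply, Pi.mul_apply,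
        weyl_apply, d]
      rw [← mul_assoc, ← mul_assoc, ← AddChar.map_add_eq_mul, ← AddChar.map_add_eq_mul]
      congr 2
      simp only [map_sub, LinearMap.sub_apply, LinearMap.add_apply, hA z v.2]
      field_simp
      ring
    · obtain ⟨r, hr⟩ : ∃ r : E → ℕ, Function.Injective r :=
        let ⟨r, hr⟩ := exists_injective_nat E; ⟨r, hr⟩
      let σ : E → ℂ := fun z => if r z ≤ r (-z) then 1 else -1
      have hσ0 : σ 0 = 1 := by simp [σ]
      have hσ1 (z : E) : σ z * σ z = 1 := by
        simp only [σ]; split_ifs <;> simp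
      have hσ2 (z : E) (hz : z ≠ 0) : σ z * σ (-z) = -1 := by
        have hne : r z ≠ r (-z) := fun h => hz (neg_eq_self_imp (k := k) h2 z (hr h).symm)
        simp only [σ, neg_neg]
        rcases lt_or_gt_of_ne hne with h | h
        · simp [h.le, not_le.2 h]
        · simp [h.le, not_le.2 h]
      have hM : mulOp σ * mulOp σ = 1 := by
        refine LinearMap.ext fun f => funext fun z => ?_
        simp [mulOp, ← mul_assoc, hσ1]
      have key : mulOp σ * (mulOp d * evenProj E + oddProj E) * mulOp σ =
          mulOp d * oddProj E + evenProj E := by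
        refine LinearMap.ext fun f => funext fun z => ?_
        simp only [Module.End.mul_apply, LinearMap.add_apply, mulOp, LinearMap.mulLeft_apply,
          Pi.mul_apply, Pi.add_apply, evenProj, oddProj, LinearMap.smul_apply, Pi.smul_apply,
          LinearMap.sub_apply, Pi.sub_apply, Module.End.one_apply, smul_eq_mul, parity,
          LinearMap.coe_mk, AddHom.coe_mk]
        by_cases hz : z = 0
        · subst hz
          simp only [hd0, neg_zero, hσ0]
          ring
        · linear_combination (2⁻¹ * (d z + 1) * f z) * hσ1 z +
            (2⁻¹ * (d z - 1) * f (-z)) * hσ2 z hz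
      have h3 := congrArg LinearMap.det hM
      rw [map_mul, map_one] at h3
      rw [detEven, detOdd, ← key, map_mul, map_mul, mul_right_comm, h3, one_mul]
  have h4 := (existsUnique_isOscillator hψ h2 g).unique (oscillator_spec hψ h2 g) hD
  rw [h4]
  rfl

end Weyl

section Char

variable (k : Type*) [Field k] [Finite k]

instance neZero_ringChar : NeZero (ringChar k) := ⟨CharP.ringChar_ne_zero_of_finite k⟩

/-- The additive character `ω(a) = exp(2πi Tr(a) / p)` of a finite field of characteristic `p`. -/
noncomputable def omega : AddChar k ℂ :=
  letI : Algebra (ZMod (ringChar k)) k := ZMod.algebra _ _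
  (ZMod.stdAddChar (N := ringChar k)).compAddMonoidHom
    (Algebra.trace (ZMod (ringChar k)) k).toAddMonoidHom

lemma omega_ne_one : omega k ≠ 1 := by
  let : Algebra (ZMod (ringChar k)) k := ZMod.algebra _ _
  obtain ⟨a, ha⟩ := FiniteField.trace_to_zmod_nondegenerate k one_ne_zero
  rw [one_mul] at ha
  refine AddChar.ne_one_iff.2 ⟨a, fun h => ha ?_⟩
  refine ZMod.injective_stdAddChar ?_
  rw [AddChar.map_zero_eq_one]
  exact h

end Char

section Pair

variable {k X U : Type*} [Field k] [AddCommGroup X] [Module k X] [AddCommGroup U] [Module k U]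

/-- The symplectic form `[x ⊕ y, x' ⊕ y'] = y' x - y x'` on `V = X ⊕ X*`. -/
def sympForm (k X : Type*) [Field k] [AddCommGroup X] [Module k X] :
    LinearMap.BilinForm k (X × Dual k X) :=
  LinearMap.mk₂ k (fun v w => w.2 v.1 - v.2 w.1)
    (by intros; simp; ring) (by intros; simp; ring) (by intros; simp; ring)
    (by intros; simp; ring)

/-- The symplectic group `Sp(V)` of `V = X ⊕ X*`. -/
abbrev Sp (k X : Type*) [Field k] [AddCommGroup X] [Module k X] :
    Subgroup ((X × Dual k X) ≃ₗ[k] (X × Dual k X)) :=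
  isometryGroup (sympForm k X)

/-- `u ⊗ y ∈ U ⊗ X*` as the map `x ↦ y x • u`. -/
noncomputable def posMap (k X U : Type*) [Field k] [AddCommGroup X] [Module k X]
    [AddCommGroup U] [Module k U] : U ⊗[k] Dual k X →ₗ[k] (X →ₗ[k] U) :=
  dualTensorHom k X U ∘ₗ (TensorProduct.comm k U (Dual k X)).toLinearMap

/-- `u ⊗ x ∈ U ⊗ X` as the linear form `F ↦ β u (F x)` on `Hom(X, U)`. -/
noncomputable def momMap (β : LinearMap.BilinForm k U) :
    U ⊗[k] X →ₗ[k] Dual k (X →ₗ[k] U) :=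
  TensorProduct.lift (LinearMap.mk₂ k
    (fun u x => β u ∘ₗ LinearMap.applyₗ x)
    (by intros; ext; simp) (by intros; ext; simp) (by intros; ext; simp) (by intros; ext; simp))

lemma posMap_tmul (u : U) (y : Dual k X) (x : X) : posMap k X U (u ⊗ₜ y) x = y x • u := by
  simp [posMap]

lemma momMap_tmul (β : LinearMap.BilinForm k U) (u : U) (x : X) (F : X →ₗ[k] U) :
    momMap β (u ⊗ₜ x) F = β u (F x) := by
  simp [momMap]

variable [FiniteDimensional k X]

lemma posMap_bijective : Function.Bijective (posMap k X U) :=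
  (dualTensorHomEquiv k X U).bijective.comp (TensorProduct.comm k U (Dual k X)).bijective

variable [FiniteDimensional k U]

lemma momMap_bijective {β : LinearMap.BilinForm k U} (hβ : β.Nondegenerate) :
    Function.Bijective (momMap (X := X) β) := by
  have hd : finrank k (U ⊗[k] X) = finrank k (Dual k (X →ₗ[k] U)) := by
    rw [Subspace.dual_finrank_eq, finrank_linearMap, finrank_tensorProduct, mul_comm]
  have hs : Function.Surjective (momMap (X := X) β) := by
    rw [← LinearMap.range_eq_top]
    have h0 : (LinearMap.range (momMap (X := X) β)).dualCoannihilator = ⊥ := by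
      refine (Submodule.eq_bot_iff _).2 fun F hF => LinearMap.ext fun x => ?_
      refine hβ.2 _ fun u => ?_
      rw [← momMap_tmul]
      exact (Submodule.mem_dualCoannihilator F).1 hF _ ⟨_, rfl⟩
    apply Submodule.eq_top_of_finrank_eq
    have h1 := Subspace.finrank_add_finrank_dualCoannihilator_eq
      (LinearMap.range (momMap (X := X) β))
    rw [h0, finrank_bot, add_zero] at h1
    rw [h1, Subspace.dual_finrank_eq]
  exact ⟨(LinearMap.injective_iff_surjective_of_finrank_eq_finrank hd).2 hs, hs⟩

/-- For `V = X ⊕ X*` and a nondegenerate form `β` on `U`, the identification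
`U ⊗ V ≃ (U ⊗ X) ⊕ (U ⊗ X*) ≃ Hom(X, U)* ⊕ Hom(X, U)`. The symplectic form on the right
corresponds to the product of `β` with the symplectic form of `V` (`phaseForm_tensorEquiv`). -/
noncomputable def tensorEquiv {β : LinearMap.BilinForm k U} (hβ : β.Nondegenerate) :
    U ⊗[k] (X × Dual k X) ≃ₗ[k] Dual k (X →ₗ[k] U) × (X →ₗ[k] U) :=
  TensorProduct.prodRight k k U X (Dual k X) ≪≫ₗ
    (LinearEquiv.ofBijective (momMap β) (momMap_bijective hβ)).prodCongr
      (LinearEquiv.ofBijective (posMap k X U) posMap_bijective)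

lemma tensorEquiv_tmul {β : LinearMap.BilinForm k U} (hβ : β.Nondegenerate) (u : U)
    (v : X × Dual k X) :
    tensorEquiv hβ (u ⊗ₜ v) = (momMap β (u ⊗ₜ v.1), posMap k X U (u ⊗ₜ v.2)) := by
  simp [tensorEquiv]

lemma phaseForm_tensorEquiv {β : LinearMap.BilinForm k U} (hβ : β.Nondegenerate)
    (hs : β.IsSymm) (u u' : U) (v v' : X × Dual k X) :
    phaseForm k (X →ₗ[k] U) (tensorEquiv hβ (u ⊗ₜ v)) (tensorEquiv hβ (u' ⊗ₜ v')) =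
      β u u' * sympForm k X v v' := by
  rw [tensorEquiv_tmul, tensorEquiv_tmul, phaseForm_apply, momMap_tmul, momMap_tmul, posMap_tmul,
    posMap_tmul, map_smul, map_smul, smul_eq_mul, smul_eq_mul, ← hs.eq u u']
  simp [sympForm]
  ring

/-- The action of `1 ⊗ g` on `U ⊗ V`, transported to phase space. -/
noncomputable def tensorMap {β : LinearMap.BilinForm k U} (hβ : β.Nondegenerate)
    (g : (X × Dual k X) ≃ₗ[k] (X × Dual k X)) :
    (Dual k (X →ₗ[k] U) × (X →ₗ[k] U)) ≃ₗ[k] (Dual k (X →ₗ[k] U) × (X →ₗ[k] U)) :=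
  (tensorEquiv hβ).symm ≪≫ₗ LinearEquiv.lTensor U g ≪≫ₗ tensorEquiv hβ

lemma tensorMap_apply {β : LinearMap.BilinForm k U} (hβ : β.Nondegenerate)
    (g : (X × Dual k X) ≃ₗ[k] (X × Dual k X)) (a : U ⊗[k] (X × Dual k X)) :
    tensorMap hβ g (tensorEquiv hβ a) = tensorEquiv hβ (LinearMap.lTensor U g.toLinearMap a) := by
  rw [tensorMap, LinearEquiv.trans_apply, LinearEquiv.trans_apply, LinearEquiv.symm_apply_apply]
  rfl

lemma tensorMap_mem {β : LinearMap.BilinForm k U} (hβ : β.Nondegenerate) (hs : β.IsSymm)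
    (g : Sp k X) : tensorMap hβ g.1 ∈ isometryGroup (phaseForm k (X →ₗ[k] U)) := by
  intro v w
  obtain ⟨a, rfl⟩ := (tensorEquiv hβ).surjective v
  obtain ⟨b, rfl⟩ := (tensorEquiv hβ).surjective w
  rw [tensorMap_apply, tensorMap_apply]
  induction a with
  | zero => simp
  | add a a' ha ha' => simp only [map_add, LinearMap.add_apply, ha, ha']
  | tmul u v =>
    induction b with
    | zero => simp
    | add b b' hb hb' => simp only [map_add, hb, hb']
    | tmul u' v' =>
      rw [LinearMap.lTensor_tmul, LinearMap.lTensor_tmul, phaseForm_tensorEquiv hβ hs,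
        phaseForm_tensorEquiv hβ hs]
      exact congrArg _ (g.2 v v')

lemma tensorMap_one {β : LinearMap.BilinForm k U} (hβ : β.Nondegenerate) :
    tensorMap (X := X) hβ 1 = 1 := by
  refine LinearEquiv.ext fun v => ?_
  obtain ⟨a, rfl⟩ := (tensorEquiv hβ).surjective v
  rw [tensorMap_apply]
  exact congrArg (tensorEquiv hβ) (LinearMap.congr_fun (LinearMap.lTensor_id U _) a)

lemma tensorMap_mul {β : LinearMap.BilinForm k U} (hβ : β.Nondegenerate)
    (g h : (X × Dual k X) ≃ₗ[k] (X × Dual k X)) :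
    tensorMap hβ (g * h) = tensorMap hβ g * tensorMap hβ h := by
  refine LinearEquiv.ext fun v => ?_
  obtain ⟨a, rfl⟩ := (tensorEquiv hβ).surjective v
  rw [LinearEquiv.mul_apply, tensorMap_apply, tensorMap_apply, tensorMap_apply]
  exact congrArg (tensorEquiv hβ)
    (LinearMap.congr_fun (LinearMap.lTensor_comp U g.toLinearMap h.toLinearMap) a)

/-- The embedding `g ↦ 1 ⊗ g` of `Sp(V)` into `Sp(U ⊗ V)`. -/
noncomputable def tensorSp {β : LinearMap.BilinForm k U} (hβ : β.Nondegenerate) (hs : β.IsSymm) :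
    Sp k X →* isometryGroup (phaseForm k (X →ₗ[k] U)) where
  toFun g := ⟨tensorMap hβ g.1, tensorMap_mem hβ hs g⟩
  map_one' := Subtype.ext (tensorMap_one hβ)
  map_mul' g h := Subtype.ext (tensorMap_mul hβ g.1 h.1)

/-- The representation `μ_{U ⊗ V}` of `Sp(V)` on the complex functions on `Hom(X, U)`: the
oscillator representation of `Sp(U ⊗ V)` for the character `ω`, restricted along `g ↦ 1 ⊗ g`. -/
noncomputable def oscillatorPair [Finite k] (hk : ringChar k ≠ 2) {β : LinearMap.BilinForm k U}
    (hβ : β.Nondegenerate) (hs : β.IsSymm) :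
    Representation ℂ (Sp k X) ((X →ₗ[k] U) → ℂ) :=
  (oscillator (omega k) (omega_ne_one k) (Ring.two_ne_zero hk)).comp (tensorSp hβ hs)

end Pair

section Rank

variable {k X U : Type*} [Field k] [AddCommGroup X] [Module k X] [AddCommGroup U] [Module k U]

/-- The element `N_A : (x, y) ↦ (x + A y, y)` of `Sp(V)`, for a symmetric `A : X* → X`. -/
def unipotent (A : Dual k X →ₗ[k] X) (hA : ∀ y y' : Dual k X, y (A y') = y' (A y)) : Sp k X :=
  ⟨{ toFun := fun v => (v.1 + A v.2, v.2)
     invFun := fun v => (v.1 - A v.2, v.2)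
     left_inv := fun v => by simp
     right_inv := fun v => by simp
     map_add' := fun v w => by ext <;> simp [add_add_add_comm]
     map_smul' := fun c v => by ext <;> simp }, fun v w => by
    simp only [sympForm, LinearMap.mk₂_apply, LinearEquiv.coe_mk, LinearMap.coe_mk, AddHom.coe_mk,
      map_add, hA v.2 w.2]
    ring⟩

/-- The symmetric map `B : X → X*` is a weight of the representation `ρ` of `Sp(V)`: the character
`N_A ↦ ω(tr(A B))` of the unipotent radical occurs in `ρ`. -/
def IsWeight [Finite k] {H : Type*} [AddCommGroup H] [Module ℂ H]
    (ρ : Representation ℂ (Sp k X) H) (B : X →ₗ[k] Dual k X) : Prop :=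
  (∀ x x', B x x' = B x' x) ∧ ∃ Φ : H, Φ ≠ 0 ∧
    ∀ (A : Dual k X →ₗ[k] X) (hA : ∀ y y' : Dual k X, y (A y') = y' (A y)),
      ρ (unipotent A hA) Φ = omega k (LinearMap.trace k X (A ∘ₗ B)) • Φ

/-- The rank of a representation of `Sp(V)`: the maximum of the ranks of its weights. -/
noncomputable def repRank [Finite k] {H : Type*} [AddCommGroup H] [Module ℂ H]
    (ρ : Representation ℂ (Sp k X) H) : ℕ :=
  sSup {r | ∃ B, IsWeight ρ B ∧ finrank k (LinearMap.range B) = r}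

/-- The tensor power CSS code `C_N` of a subspace `N` of `U`: the functions on `Hom(X, U)` that are
supported on `Hom(X, N^⊥)` and constant on the cosets of `Hom(X, N)`. -/
def cssCode (X : Type*) [AddCommGroup X] [Module k X] (β : LinearMap.BilinForm k U)
    (N : Submodule k U) : Submodule ℂ ((X →ₗ[k] U) → ℂ) where
  carrier := {Φ | (∀ F, Φ F ≠ 0 → LinearMap.range F ≤ β.orthogonal N) ∧
    ∀ F F', LinearMap.range (F - F') ≤ N → Φ F = Φ F'}
  add_mem' {Φ Ψ} hΦ hΨ := by
    refine ⟨fun F hF => ?_, fun F F' h => ?_⟩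
    · by_cases h : Φ F = 0
      · exact hΨ.1 F fun h' => hF (by simp [h, h'])
      · exact hΦ.1 F h
    · simp [hΦ.2 F F' h, hΨ.2 F F' h]
  zero_mem' := ⟨fun F hF => absurd rfl hF, fun _ _ _ => rfl⟩
  smul_mem' c Φ hΦ := by
    refine ⟨fun F hF => hΦ.1 F fun h => hF (by simp [h]), fun F F' h => ?_⟩
    simp [hΦ.2 F F' h]

/-- `N_A` acts by `δ_F ↦ ω(tr(A Fᵀ F) / 2) δ_F`, where `Fᵀ F` is the form
`(x, x') ↦ β(F x, F x')`. So `δ_F` has the weight `Fᵀ F / 2`. -/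
lemma oscillatorPair_unipotent [Finite k] [FiniteDimensional k X] [FiniteDimensional k U]
    (hk : ringChar k ≠ 2) {β : LinearMap.BilinForm k U} (hβ : β.Nondegenerate) (hs : β.IsSymm)
    (A : Dual k X →ₗ[k] X) (hA : ∀ y y' : Dual k X, y (A y') = y' (A y)) (Φ : (X →ₗ[k] U) → ℂ)
    (F : X →ₗ[k] U) :
    oscillatorPair hk hβ hs (unipotent A hA) Φ F =
      omega k (2⁻¹ * LinearMap.trace k X (A ∘ₗ β.compl₁₂ F F)) * Φ F := by
  let A' : (X →ₗ[k] U) →ₗ[k] Dual k (X →ₗ[k] U) := LinearMap.mk₂ k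
    (fun F G => LinearMap.trace k X (A ∘ₗ β.compl₁₂ G F))
    (fun F F' G => by
      rw [← map_add, ← LinearMap.comp_add]; congr 2; ext; simp)
    (fun c F G => by
      rw [← map_smul, ← LinearMap.comp_smul]; congr 2; ext; simp)
    (fun F G G' => by
      rw [← map_add, ← LinearMap.comp_add]; congr 2; ext; simp)
    (fun c F G => by
      rw [← map_smul, ← LinearMap.comp_smul]; congr 2; ext; simp)
  have h1 (u : U) (y : Dual k X) : momMap β (u ⊗ₜ A y) = A' (posMap k X U (u ⊗ₜ y)) := by
    ext G
    rw [momMap_tmul]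
    have : A ∘ₗ β.compl₁₂ G (posMap k X U (u ⊗ₜ y)) =
        (β u ∘ₗ G).smulRight (A y) := by
      ext x
      have : (β.compl₁₂ G (posMap k X U (u ⊗ₜ y))) x = β u (G x) • y := by
        ext x'
        simp [posMap_tmul, ← hs.eq u (G x), mul_comm]
      simp [this]
    simp only [A', LinearMap.mk₂_apply, this]
    simp
  have h2 (F G : X →ₗ[k] U) : A' F G = A' G F := by
    obtain ⟨a, rfl⟩ := posMap_bijective.2 F
    obtain ⟨b, rfl⟩ := posMap_bijective.2 G
    induction a with
    | zero => simp
    | add a a' h h' => simp only [map_add, LinearMap.add_apply, h, h']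
    | tmul u y =>
      induction b with
      | zero => simp
      | add b b' h h' => simp only [map_add, LinearMap.add_apply, h, h']
      | tmul u' y' =>
        rw [← h1, ← h1, momMap_tmul, momMap_tmul, posMap_tmul, posMap_tmul, map_smul, map_smul,
          ← hs.eq u u', hA y' y]
  have h3 := oscillator_shear (omega_ne_one k) (Ring.two_ne_zero hk)
    (tensorSp hβ hs (unipotent A hA)) A' h2 ?_ Φ F
  · exact h3
  · intro v
    obtain ⟨a, rfl⟩ := (tensorEquiv hβ).surjective v
    change tensorMap hβ (unipotent A hA).1 (tensorEquiv hβ a) = _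
    rw [tensorMap_apply]
    induction a with
    | zero => simp only [map_zero, Prod.fst_zero, Prod.snd_zero, add_zero]; rfl
    | add a a' h h' =>
      simp only [map_add, h, h', Prod.fst_add, Prod.snd_add]
      ext1
      · simp only [Prod.mk_add_mk]; abel
      · rfl
    | tmul u v =>
      rw [LinearMap.lTensor_tmul, tensorEquiv_tmul, tensorEquiv_tmul]
      simp only [← h1, ← map_add, ← TensorProduct.tmul_add]
      rfl

end Rank
end Oscillator

/-!
Write `V = X ⊕ X*`. By `oscillatorPair_unipotent` the delta function at `F : X → U` has the weight
`F^* β / 2`, so the rank of a subrepresentation `K` is the largest rank `r` of a form `F^* β` with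
`F` in the support of an element of `K` (`repRank_spec`). It has to be shown that a `K` supported on
forms of rank at most `r` lies in the span of the codes `C_N` with `dim N ≥ (t - r) / 2`
(`le_codeSpan`). The converse bound, that on `C_N` the forms have rank at most `t - 2 dim N`, is
linear algebra, and the two bounds together give the parity of `t - r`.

The only elements of `Sp(V)` that are needed besides the `N_A` are the rotations of the plane
spanned by `x ∈ X` and `ξ ∈ X*` with `ξ x = 1`. They act, up to a scalar, by the Fourier transform
in the value `F x ∈ U` (`partialFourier_mem`). Let `F^* β` have the maximal rank `r < t` and let
`F x = 0`. Both `u ↦ f (F + ξ ⊗ u)` and its Fourier transform are supported on those `u` for which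
`F + ξ ⊗ u` has a form of rank at most `r`. This has two consequences.

* If `F` has the range `P` of largest dimension among the maps of rank `r` in the support of `f`,
  then the function is supported on `P`. So its Fourier transform is invariant under `P^⊥`, and
  the rank condition forces `P^⊥` to be isotropic (`exists_coisotropic_range`). Then `P = N^⊥` with
  `N` isotropic and `r = t - 2 dim N`.
* If `F` has the range `N^⊥` with `N` isotropic, then the Fourier transform is supported on `N^⊥`,
  so the function is invariant under `N`. Such moves connect any two maps of range `N^⊥` in the same
  coset of `Hom(X, N)`, so `f` is constant on them (`eq_of_range_eq`).

By the second point, extending the values of `f` at the maps of range `N^⊥` to the cosets of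
`Hom(X, N)` yields an element of `C_N`. Subtract these from `f`, for all `N` of dimension
`d = (t - r) / 2`. The difference vanishes at all maps of coisotropic range and rank `r`, hence, by
the first point, at all maps of rank `r` (`exists_mem_codeSpan_eq`). As the restriction to the maps
of rank `r` is a sum of projections to weight spaces, it preserves subrepresentations. So a
complement of the span of the codes in the sum of that span and `K` has rank less than `r`, and
induction on `r` concludes. The codes are subrepresentations because `C_N` is the space of fixed
vectors of the Weyl operators of `N ⊗ V` (`mem_cssCode_iff`).
-/

namespace Oscillator

/-! ### Ranks of pulled back forms -/

section FormRank

variable {k X U : Type*} [Field k] [AddCommGroup X] [Module k X] [AddCommGroup U] [Module k U]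

/-- The rank of the form `(x, x') ↦ β(F x, F x')` pulled back along `F : X → U`. Up to the factor
`1 / 2` this form is the weight of the delta function at `F`. -/
noncomputable def formRank (β : LinearMap.BilinForm k U) (F : X →ₗ[k] U) : ℕ :=
  finrank k (LinearMap.range (β.compl₁₂ F F))

/-- A subspace on which `β(u, u)` vanishes is isotropic, as the characteristic is not `2`. -/
lemma le_orthogonal_of_forall_self {β : LinearMap.BilinForm k U} (hs : β.IsSymm)
    (h2 : (2 : k) ≠ 0) {P : Submodule k U} (h : ∀ u ∈ P, β u u = 0) : P ≤ β.orthogonal P := by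
  intro u hu
  rw [LinearMap.BilinForm.mem_orthogonal_iff]
  intro v hv
  have h1 := h _ (P.add_mem hu hv)
  have h3 : β u v = β v u := hs.eq u v
  simp only [map_add, LinearMap.add_apply, h u hu, h v hv, h3] at h1
  refine (mul_eq_zero.1 (?_ : (2 : k) * β v u = 0)).resolve_left h2
  linear_combination h1

lemma finrank_range_comp_le_left {V W Z : Type*} [AddCommGroup V] [Module k V] [AddCommGroup W]
    [Module k W] [AddCommGroup Z] [Module k Z] [FiniteDimensional k W] (f : V →ₗ[k] W)
    (g : W →ₗ[k] Z) : finrank k (LinearMap.range (g ∘ₗ f)) ≤ finrank k (LinearMap.range f) := by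
  rw [LinearMap.range_comp]
  exact Submodule.finrank_map_le _ _

lemma finrank_range_comp_le_right {V W Z : Type*} [AddCommGroup V] [Module k V] [AddCommGroup W]
    [Module k W] [AddCommGroup Z] [Module k Z] [FiniteDimensional k Z] (f : V →ₗ[k] W)
    (g : W →ₗ[k] Z) : finrank k (LinearMap.range (g ∘ₗ f)) ≤ finrank k (LinearMap.range g) :=
  Submodule.finrank_mono (LinearMap.range_comp_le_range f g)

variable [FiniteDimensional k X]

lemma formRank_comp_le (β : LinearMap.BilinForm k U) (F : X →ₗ[k] U) (π : X →ₗ[k] X) :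
    formRank β (F ∘ₗ π) ≤ formRank β F := by
  have : β.compl₁₂ (F ∘ₗ π) (F ∘ₗ π) = π.dualMap ∘ₗ (β.compl₁₂ F F ∘ₗ π) := by
    ext; simp
  rw [formRank, formRank, this]
  exact (finrank_range_comp_le_left _ _).trans (finrank_range_comp_le_right _ _)

/-- If precomposition with `π` does not lower the rank of a form, then a vector orthogonal to the
range of `π` lies in the radical. -/
lemma mem_radical_of_formRank_le {β : LinearMap.BilinForm k U} {F : X →ₗ[k] U} {π : X →ₗ[k] X}
    (h : formRank β F ≤ formRank β (F ∘ₗ π)) {z : X} (hz : ∀ z', β (F z) (F (π z')) = 0) (z' : X) :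
    β (F z) (F z') = 0 := by
  let D := β.compl₁₂ F F
  have e : β.compl₁₂ (F ∘ₗ π) (F ∘ₗ π) = (π.dualMap ∘ₗ D) ∘ₗ π := by
    ext; simp [D]
  -- The restriction `π.dualMap` is injective on the range of `D`, by comparison of dimensions.
  have h1 : finrank k (LinearMap.range D) ≤ finrank k (LinearMap.range (π.dualMap ∘ₗ D)) := by
    refine h.trans ?_
    rw [formRank, e]
    exact finrank_range_comp_le_right _ _
  have h2 := LinearMap.finrank_range_add_finrank_ker D
  have h3 := LinearMap.finrank_range_add_finrank_ker (π.dualMap ∘ₗ D)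
  have h4 : LinearMap.ker D = LinearMap.ker (π.dualMap ∘ₗ D) :=
    Submodule.eq_of_le_of_finrank_le (LinearMap.ker_le_ker_comp _ _) (by omega)
  have h5 : z ∈ LinearMap.ker D := by
    rw [h4, LinearMap.mem_ker]
    ext z'
    simpa [D] using hz z'
  simpa [D] using LinearMap.congr_fun (LinearMap.mem_ker.1 h5) z'

variable [FiniteDimensional k U]

/-- The rank of a pulled back form is the dimension of the range modulo its radical. -/
lemma formRank_add {β : LinearMap.BilinForm k U} (hs : β.IsSymm) (F : X →ₗ[k] U) :
    formRank β F + finrank k (LinearMap.range F ⊓ β.orthogonal (LinearMap.range F) :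
      Submodule k U) = finrank k (LinearMap.range F) := by
  have h1 := LinearMap.finrank_range_add_finrank_ker (β.compl₁₂ F F)
  have h2 := LinearMap.finrank_range_add_finrank_ker F
  have h3 : LinearMap.ker (β.compl₁₂ F F) = (β.orthogonal (LinearMap.range F)).comap F := by
    ext z
    simp [LinearMap.ext_iff, LinearMap.BilinForm.mem_orthogonal_iff, hs.eq (F z)]
  have h4 := LinearMap.finrank_range_add_finrank_ker
    (F.domRestrict ((β.orthogonal (LinearMap.range F)).comap F))
  rw [LinearMap.range_domRestrict, Submodule.map_comap_eq, LinearMap.ker_domRestrict,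
    ← h3] at h4
  have h5 : finrank k ((LinearMap.ker F).submoduleOf (LinearMap.ker (β.compl₁₂ F F))) =
      finrank k (LinearMap.ker F) := by
    refine (Submodule.submoduleOfEquivOfLe fun z hz => ?_).finrank_eq
    rw [LinearMap.mem_ker] at hz ⊢
    ext z'
    simp [hz]
  rw [Submodule.submoduleOf] at h5
  rw [formRank]
  omega

lemma formRank_add_of_range_eq {β : LinearMap.BilinForm k U} (hβ : β.Nondegenerate)
    (hs : β.IsSymm) {N : Submodule k U} (hN : N ≤ β.orthogonal N) {F : X →ₗ[k] U}
    (hF : LinearMap.range F = β.orthogonal N) : formRank β F + 2 * finrank k N = finrank k U := by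
  have h1 := formRank_add hs F
  have h2 := LinearMap.BilinForm.finrank_orthogonal hβ N
  have h3 := Submodule.finrank_le N
  rw [hF, LinearMap.BilinForm.orthogonal_orthogonal hβ hs.isRefl, inf_eq_right.2 hN] at h1
  omega

lemma formRank_add_le {β : LinearMap.BilinForm k U} (hβ : β.Nondegenerate) (hs : β.IsSymm)
    {N : Submodule k U} (hN : N ≤ β.orthogonal N) {F : X →ₗ[k] U}
    (hF : LinearMap.range F ≤ β.orthogonal N) : formRank β F + 2 * finrank k N ≤ finrank k U := by
  have h1 := formRank_add hs F
  have h2 := LinearMap.BilinForm.finrank_orthogonal hβ N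
  have h3 := Submodule.finrank_le N
  have h4 := Submodule.finrank_sup_add_finrank_inf_eq (LinearMap.range F) N
  have h5 : finrank k (LinearMap.range F ⊔ N : Submodule k U) ≤ finrank k (β.orthogonal N) :=
    Submodule.finrank_mono (sup_le hF hN)
  have h6 : finrank k (LinearMap.range F ⊓ N : Submodule k U) ≤
      finrank k (LinearMap.range F ⊓ β.orthogonal (LinearMap.range F) : Submodule k U) := by
    refine Submodule.finrank_mono (inf_le_inf_left _ fun u hu => ?_)
    rw [LinearMap.BilinForm.mem_orthogonal_iff]
    intro v hv
    exact (hs.eq v u).trans ((LinearMap.BilinForm.mem_orthogonal_iff.1 (hF hv)) u hu)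
  omega

lemma orthogonal_inf_orthogonal_le {β : LinearMap.BilinForm k U} (hβ : β.Nondegenerate)
    (hs : β.IsSymm) (P : Submodule k U) :
    β.orthogonal (P ⊓ β.orthogonal P) ≤ P ⊔ β.orthogonal P := by
  have h : β.orthogonal (P ⊔ β.orthogonal P) ≤ P ⊓ β.orthogonal P := by
    refine le_inf ?_ (LinearMap.BilinForm.orthogonal_le le_sup_left)
    conv_rhs => rw [← LinearMap.BilinForm.orthogonal_orthogonal hβ hs.isRefl P]
    exact LinearMap.BilinForm.orthogonal_le le_sup_right
  rw [← LinearMap.BilinForm.orthogonal_orthogonal hβ hs.isRefl (P ⊔ β.orthogonal P)]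
  exact LinearMap.BilinForm.orthogonal_le h

end FormRank

/-! ### The partial Fourier transform -/

section Fourier

variable {k U : Type*} [Field k] [AddCommGroup U] [Module k U] [Fintype U]
  {β : LinearMap.BilinForm k U} {ψ : AddChar k ℂ}

/-- Fourier inversion for the self-duality of `U` given by `β`. -/
lemma fourier_inversion (hβ : β.Nondegenerate) (hψ : ψ ≠ 1) (φ : U → ℂ) (u : U) :
    ∑ v, ψ (-β u v) * ∑ w, ψ (β w v) * φ w = Fintype.card U * φ u := by
  classical
  have h (w : U) : ∑ v, ψ (-β u v) * ψ (β w v) = if w = u then (Fintype.card U : ℂ) else 0 := by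
    split_ifs with hw
    · subst hw
      simp [← AddChar.map_add_eq_mul]
    · have h0 : β (w - u) ≠ 0 := fun h0 =>
        hw (sub_eq_zero.1 (hβ.1 _ fun v => by rw [h0, LinearMap.zero_apply]))
      rw [← sum_char hψ h0]
      refine Finset.sum_congr rfl fun v _ => ?_
      rw [← AddChar.map_add_eq_mul]
      congr 1
      simp [sub_eq_neg_add]
  calc ∑ v, ψ (-β u v) * ∑ w, ψ (β w v) * φ w
      = ∑ w, (∑ v, ψ (-β u v) * ψ (β w v)) * φ w := by
        simp only [Finset.mul_sum, Finset.sum_mul, mul_assoc]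
        exact Finset.sum_comm
    _ = _ := by simp [h]

lemma exists_fourier_ne_zero (hβ : β.Nondegenerate) (hψ : ψ ≠ 1) {φ : U → ℂ} {u : U}
    (hu : φ u ≠ 0) : ∃ v, ∑ w, ψ (β w v) * φ w ≠ 0 := by
  by_contra! h
  have := fourier_inversion hβ hψ φ u
  simp only [h, mul_zero, Finset.sum_const_zero] at this
  exact (mul_ne_zero (by exact_mod_cast Fintype.card_ne_zero) hu) this.symm

/-- If the Fourier transform is supported on `s^⊥`, then the function is invariant under `s`. -/
lemma eq_of_fourier_support (hβ : β.Nondegenerate) (hψ : ψ ≠ 1) {φ : U → ℂ} {s : U}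
    (h : ∀ v, ∑ w, ψ (β w v) * φ w ≠ 0 → β s v = 0) (u : U) : φ (u + s) = φ u := by
  have h1 := fourier_inversion hβ hψ φ u
  have h2 := fourier_inversion hβ hψ φ (u + s)
  refine mul_left_cancel₀ (a := (Fintype.card U : ℂ)) (by exact_mod_cast Fintype.card_ne_zero) ?_
  rw [← h1, ← h2]
  refine Finset.sum_congr rfl fun v _ => ?_
  by_cases hv : ∑ w, ψ (β w v) * φ w = 0
  · rw [hv, mul_zero, mul_zero]
  · rw [map_add, LinearMap.add_apply, h v hv, add_zero]

end Fourier

section PartialFourier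

variable {k X U : Type*} [Field k] [AddCommGroup X] [Module k X] [AddCommGroup U] [Module k U]

/-- For `ξ x = 1`, the element of `Sp(V)` that acts on the hyperbolic plane spanned by `x` and `ξ`
by `x ↦ -ξ`, `ξ ↦ x`, and trivially on its orthogonal complement. -/
def planeRotation (x : X) (ξ : Dual k X) (h : ξ x = 1) : Sp k X :=
  ⟨{ toFun := fun v => (v.1 + (v.2 x - ξ v.1) • x, v.2 - (v.2 x + ξ v.1) • ξ)
     invFun := fun v => (v.1 - (v.2 x + ξ v.1) • x, v.2 + (ξ v.1 - v.2 x) • ξ)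
     left_inv := fun v => Prod.ext (by simp [h]; module) (by simp [h])
     right_inv := fun v => Prod.ext (by simp [h]; module) (by simp [h]; module)
     map_add' := fun v w => Prod.ext (by simp; module) (by simp; module)
     map_smul' := fun c v => Prod.ext (by simp; module) (by simp; module) }, fun v w => by
    simp [sympForm, h]
    ring⟩

lemma planeRotation_apply (x : X) (ξ : Dual k X) (h : ξ x = 1) (v : X × Dual k X) :
    (planeRotation x ξ h).1 v = (v.1 + (v.2 x - ξ v.1) • x, v.2 - (v.2 x + ξ v.1) • ξ) := rfl

/-- The Fourier transform in the value at `x`: for `ξ x = 1`, the map `F + ξ ⊗ (u - F x)` agrees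
with `F` on the kernel of `ξ` and sends `x` to `u`. -/
def partialFourier [Fintype U] (ψ : AddChar k ℂ) (β : LinearMap.BilinForm k U) (x : X)
    (ξ : Dual k X) : End ℂ ((X →ₗ[k] U) → ℂ) where
  toFun f F := ∑ u, ψ (β u (F x)) * f (F + ξ.smulRight (u - F x))
  map_add' f g := by ext F; simp [mul_add, Finset.sum_add_distrib]
  map_smul' c f := by ext F; simp [Finset.mul_sum, mul_left_comm]

lemma partialFourier_apply [Fintype U] (ψ : AddChar k ℂ) (β : LinearMap.BilinForm k U) (x : X)
    (ξ : Dual k X) (f : (X →ₗ[k] U) → ℂ) (F : X →ₗ[k] U) :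
    partialFourier ψ β x ξ f F = ∑ u, ψ (β u (F x)) * f (F + ξ.smulRight (u - F x)) := rfl

/-- Along the line of maps that differ from `F` only in the value at `x`, with `F x = 0`, the
partial Fourier transform is the Fourier transform on `U`. -/
lemma partialFourier_slice [Fintype U] (ψ : AddChar k ℂ) (β : LinearMap.BilinForm k U) {x : X}
    {ξ : Dual k X} (h : ξ x = 1) (f : (X →ₗ[k] U) → ℂ) {F : X →ₗ[k] U} (hF : F x = 0) (v : U) :
    partialFourier ψ β x ξ f (F + ξ.smulRight v) =
      ∑ u, ψ (β u v) * f (F + ξ.smulRight u) := by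
  rw [partialFourier_apply]
  refine Finset.sum_congr rfl fun u _ => ?_
  have h1 : (F + ξ.smulRight v) x = v := by simp [hF, h]
  rw [h1]
  congr 2
  ext z
  simp only [LinearMap.add_apply, LinearMap.smulRight_apply]
  module

variable [FiniteDimensional k X] [FiniteDimensional k U]

lemma weyl_tensorEquiv_apply (ψ : AddChar k ℂ) {β : LinearMap.BilinForm k U} (hβ : β.Nondegenerate)
    (u : U) (v : X × Dual k X) (f : (X →ₗ[k] U) → ℂ) (F : X →ₗ[k] U) :
    weyl ψ (tensorEquiv hβ (u ⊗ₜ v)) f F =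
      ψ (β u (F v.1) - 2⁻¹ * (v.2 v.1 * β u u)) * f (F - v.2.smulRight u) := by
  have h : posMap k X U (u ⊗ₜ v.2) = v.2.smulRight u := by
    ext z
    rw [posMap_tmul, LinearMap.smulRight_apply]
  rw [weyl_apply, tensorEquiv_tmul, momMap_tmul, momMap_tmul, posMap_tmul, h, map_smul, smul_eq_mul]

/-- The partial Fourier transform intertwines the Weyl operators along the rotation of the plane
spanned by `x` and `ξ`. -/
lemma partialFourier_mul_weyl [Fintype U] (ψ : AddChar k ℂ) (h2 : (2 : k) ≠ 0)
    {β : LinearMap.BilinForm k U} (hβ : β.Nondegenerate) (hs : β.IsSymm) {x : X} {ξ : Dual k X}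
    (h : ξ x = 1) (v : Dual k (X →ₗ[k] U) × (X →ₗ[k] U)) :
    partialFourier ψ β x ξ * weyl ψ v =
      weyl ψ ((tensorSp hβ hs (planeRotation x ξ h)).1 v) * partialFourier ψ β x ξ := by
  set g := tensorSp hβ hs (planeRotation x ξ h) with hg
  have hadd (v w : Dual k (X →ₗ[k] U) × (X →ₗ[k] U))
      (hv : partialFourier ψ β x ξ * weyl ψ v = weyl ψ (g.1 v) * partialFourier ψ β x ξ)
      (hw : partialFourier ψ β x ξ * weyl ψ w = weyl ψ (g.1 w) * partialFourier ψ β x ξ) :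
      partialFourier ψ β x ξ * weyl ψ (v + w) =
        weyl ψ (g.1 (v + w)) * partialFourier ψ β x ξ := by
    have e (v w : Dual k (X →ₗ[k] U) × (X →ₗ[k] U)) : weyl ψ (v + w) =
        ψ (-(2⁻¹ * phaseForm k _ v w)) • (weyl ψ v * weyl ψ w) := by
      rw [weyl_mul ψ h2, smul_smul, ← AddChar.map_add_eq_mul, neg_add_cancel,
        AddChar.map_zero_eq_one, one_smul]
    rw [map_add, e, e (g.1 v), g.2 v w, mul_smul_comm, smul_mul_assoc, ← mul_assoc, hv, mul_assoc,
      hw, mul_assoc]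
  obtain ⟨a, rfl⟩ := (tensorEquiv hβ).surjective v
  induction a with
  | zero => simp [weyl_zero]
  | add a b ha hb => rw [map_add]; exact hadd _ _ ha hb
  | tmul u v =>
    have hgt (w : X × Dual k X) : g.1 (tensorEquiv hβ (u ⊗ₜ w)) =
        tensorEquiv hβ (u ⊗ₜ (planeRotation x ξ h).1 w) := by
      change tensorMap hβ (planeRotation x ξ h).1 (tensorEquiv hβ (u ⊗ₜ w)) = _
      rw [tensorMap_apply]
      rfl
    have hv : v = (v.1, 0) + (0, v.2) := by simp
    rw [hv, TensorProduct.tmul_add, map_add]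
    refine hadd _ _ ?_ ?_
    · refine LinearMap.ext fun f => funext fun F => ?_
      simp only [hgt, planeRotation_apply, Module.End.mul_apply, partialFourier_apply,
        weyl_tensorEquiv_apply, Finset.mul_sum, ← mul_assoc, ← AddChar.map_add_eq_mul]
      refine Finset.sum_congr rfl fun w _ => ?_
      congr 2
      · simp [h, hs.eq w u]
        ring
      · ext z
        simp [h]
        module
    · refine LinearMap.ext fun f => funext fun F => ?_
      simp only [hgt, planeRotation_apply, Module.End.mul_apply, partialFourier_apply,
        weyl_tensorEquiv_apply, Finset.mul_sum, ← mul_assoc, ← AddChar.map_add_eq_mul]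
      refine Fintype.sum_equiv (Equiv.subRight (v.2 x • u)) _ _ fun w => ?_
      congr 2
      · simp [h]
      · ext z
        simp [h]
        module

variable [Finite k]

/-- Subrepresentations are stable under the partial Fourier transforms, which are scalar multiples
of operators of the group. -/
lemma partialFourier_mem [Fintype U] {hk : ringChar k ≠ 2} {β : LinearMap.BilinForm k U}
    {hβ : β.Nondegenerate} {hs : β.IsSymm} (K : Subrepresentation (oscillatorPair (X := X) hk hβ hs))
    {x : X} {ξ : Dual k X} (h : ξ x = 1) {f : (X →ₗ[k] U) → ℂ} (hf : f ∈ K.toSubmodule) :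
    partialFourier (omega k) β x ξ f ∈ K.toSubmodule := by
  have h2 := Ring.two_ne_zero hk
  set g := tensorSp hβ hs (planeRotation x ξ h)
  have hT := oscillator_spec (omega_ne_one k) h2 g
  obtain ⟨c, hc⟩ := intertwiner_unique (omega_ne_one k) hT.ne_zero hT.intertwines
    (partialFourier_mul_weyl (omega k) h2 hβ hs h)
  rw [hc]
  exact K.toSubmodule.smul_mem c (K.apply_mem_toSubmodule (planeRotation x ξ h) hf)

end PartialFourier

/-! ### The codes are subrepresentations -/

section Codes

variable {k X U : Type*} [Field k] [AddCommGroup X] [Module k X] [AddCommGroup U] [Module k U]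

lemma cssCode_bot (β : LinearMap.BilinForm k U) : cssCode X β ⊥ = ⊤ := by
  refine eq_top_iff.2 fun f _ => ⟨fun F _ => by simp, fun F F' h => ?_⟩
  rw [sub_eq_zero.1 (LinearMap.range_eq_bot.1 (le_bot_iff.1 h))]

lemma cssCode_anti (β : LinearMap.BilinForm k U) {N M : Submodule k U} (h : N ≤ M) :
    cssCode X β M ≤ cssCode X β N := fun _ hf =>
  ⟨fun F hF => (hf.1 F hF).trans (LinearMap.BilinForm.orthogonal_le h),
    fun F F' hFF => hf.2 F F' (hFF.trans h)⟩

/-- The span of the codes `C_N` with `N` isotropic of dimension `d`. -/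
def codeSpan (X : Type*) [AddCommGroup X] [Module k X] (β : LinearMap.BilinForm k U) (d : ℕ) :
    Submodule ℂ ((X →ₗ[k] U) → ℂ) :=
  ⨆ (N : Submodule k U) (_ : N ≤ β.orthogonal N) (_ : finrank k N = d), cssCode X β N

lemma cssCode_le_codeSpan (β : LinearMap.BilinForm k U) {N : Submodule k U}
    (hN : N ≤ β.orthogonal N) : cssCode X β N ≤ codeSpan X β (finrank k N) :=
  le_iSup_of_le N (le_iSup_of_le hN (le_iSup_of_le rfl le_rfl))

lemma codeSpan_le {β : LinearMap.BilinForm k U} {d : ℕ} {S : Submodule ℂ ((X →ₗ[k] U) → ℂ)}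
    (h : ∀ N : Submodule k U, N ≤ β.orthogonal N → finrank k N = d → cssCode X β N ≤ S) :
    codeSpan X β d ≤ S :=
  iSup_le fun N => iSup_le fun hN => iSup_le fun hd => h N hN hd

lemma codeSpan_zero (β : LinearMap.BilinForm k U) : codeSpan X β 0 = ⊤ := by
  refine eq_top_iff.2 ?_
  rw [← cssCode_bot (X := X) β, ← finrank_bot k U]
  exact cssCode_le_codeSpan β bot_le

/-- A map with values in `N` is a sum of maps of rank one with values in `N`. -/
lemma mem_closure_of_range_le [FiniteDimensional k X] {N : Submodule k U} {G : X →ₗ[k] U}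
    (hG : LinearMap.range G ≤ N) :
    G ∈ AddSubmonoid.closure {G | ∃ u ∈ N, ∃ y : Dual k X, G = y.smulRight u} := by
  let b := Module.finBasis k X
  have : G = ∑ i, (b.coord i).smulRight (G (b i)) := by
    refine b.ext fun j => ?_
    simp [Finsupp.single_apply]
  rw [this]
  exact sum_mem fun i _ => AddSubmonoid.subset_closure ⟨_, hG ⟨_, rfl⟩, _, rfl⟩

lemma codeSpan_anti (β : LinearMap.BilinForm k U) {d e : ℕ} (h : d ≤ e) :
    codeSpan X β e ≤ codeSpan X β d := by
  refine codeSpan_le fun M hM hMe => ?_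
  obtain ⟨N, hN, rfl⟩ : ∃ N ≤ M, finrank k N = d := by
    obtain ⟨v, hv⟩ := exists_linearIndependent_of_le_finrank (R := k) (M := M) (hMe ▸ h)
    refine ⟨(Submodule.span k (Set.range v)).map M.subtype, Submodule.map_subtype_le _ _, ?_⟩
    rw [Submodule.finrank_map_subtype_eq, finrank_span_eq_card hv, Fintype.card_fin]
  exact (cssCode_anti β hN).trans (cssCode_le_codeSpan β
    (hN.trans (hM.trans (LinearMap.BilinForm.orthogonal_le hN))))

variable [FiniteDimensional k X] [FiniteDimensional k U]

/-- The code `C_N` of an isotropic subspace `N` consists of the common fixed vectors of the Weyl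
operators of `N ⊗ V`. -/
lemma mem_cssCode_iff {ψ : AddChar k ℂ} (hψ : ψ ≠ 1) {β : LinearMap.BilinForm k U}
    (hβ : β.Nondegenerate) {N : Submodule k U} (hN : N ≤ β.orthogonal N)
    {f : (X →ₗ[k] U) → ℂ} : f ∈ cssCode X β N ↔
      ∀ u ∈ N, ∀ v : X × Dual k X, weyl ψ (tensorEquiv hβ (u ⊗ₜ v)) f = f := by
  have h0 {u : U} (hu : u ∈ N) : β u u = 0 := LinearMap.BilinForm.mem_orthogonal_iff.1 (hN hu) u hu
  constructor
  · intro hf u hu v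
    ext F
    have h1 : f (F - v.2.smulRight u) = f F := by
      refine hf.2 _ _ ?_
      rintro _ ⟨z, rfl⟩
      simpa using N.smul_mem _ (N.neg_mem hu)
    rw [weyl_tensorEquiv_apply, h1, h0 hu, mul_zero, mul_zero, sub_zero]
    by_cases hF : f F = 0
    · simp [hF]
    · rw [LinearMap.BilinForm.mem_orthogonal_iff.1 (hf.1 F hF ⟨v.1, rfl⟩) u hu,
        AddChar.map_zero_eq_one, one_mul]
  · intro hf
    refine ⟨fun F hF => ?_, fun F F' h => ?_⟩
    · rintro _ ⟨z, rfl⟩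
      rw [LinearMap.BilinForm.mem_orthogonal_iff]
      intro u hu
      by_contra hne
      obtain ⟨a, ha⟩ := AddChar.ne_one_iff.1 hψ
      have h1 := congrFun (hf u hu ((a * (β u (F z))⁻¹) • z, 0)) F
      rw [weyl_tensorEquiv_apply] at h1
      simp only [map_smul, smul_eq_mul, inv_mul_cancel_right₀ hne, LinearMap.zero_apply, zero_mul,
        mul_zero, sub_zero, LinearMap.zero_smulRight] at h1
      exact ha ((mul_eq_right₀ hF).1 h1)
    · have h1 : ∀ G ∈ AddSubmonoid.closure {G | ∃ u ∈ N, ∃ y : Dual k X, G = y.smulRight u},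
          ∀ F, f (F + G) = f F := by
        intro G hG
        induction hG using AddSubmonoid.closure_induction with
        | mem G hG =>
          obtain ⟨u, hu, y, rfl⟩ := hG
          intro F
          have h2 := congrFun (hf u hu (0, y)) (F + y.smulRight u)
          rw [weyl_tensorEquiv_apply] at h2
          simpa using h2.symm
        | zero => simp
        | add G G' _ _ h h' => intro F; rw [← add_assoc, h', h]
      have h2 := h1 _ (mem_closure_of_range_le h) F'
      rwa [add_sub_cancel] at h2

variable [Finite k]

lemma cssCode_invariant (hk : ringChar k ≠ 2) {β : LinearMap.BilinForm k U}
    (hβ : β.Nondegenerate) (hs : β.IsSymm) {N : Submodule k U} (hN : N ≤ β.orthogonal N)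
    (g : Sp k X) {f : (X →ₗ[k] U) → ℂ} (hf : f ∈ cssCode X β N) :
    oscillatorPair hk hβ hs g f ∈ cssCode X β N := by
  rw [mem_cssCode_iff (omega_ne_one k) hβ hN] at hf ⊢
  intro u hu v
  have h1 := (oscillator_spec (omega_ne_one k) (Ring.two_ne_zero hk) (tensorSp hβ hs g)).intertwines
    (tensorEquiv hβ (u ⊗ₜ g⁻¹.1 v))
  have h2 : (tensorSp hβ hs g).1 (tensorEquiv hβ (u ⊗ₜ g⁻¹.1 v)) = tensorEquiv hβ (u ⊗ₜ v) := by
    change tensorMap hβ g.1 (tensorEquiv hβ (u ⊗ₜ g⁻¹.1 v)) = _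
    rw [tensorMap_apply]
    have : g.1 (g⁻¹.1 v) = v := by
      rw [← LinearEquiv.mul_apply, ← Subgroup.coe_mul, mul_inv_cancel]; rfl
    exact congrArg (fun w => tensorEquiv hβ (u ⊗ₜ w)) this
  have h3 := congrArg (fun T : End ℂ ((X →ₗ[k] U) → ℂ) => T f) h1
  simp only [Module.End.mul_apply, h2, hf u hu] at h3
  exact h3.symm

/-- The span of the codes of dimension `d`, as a subrepresentation. -/
def codeSubrep (X : Type*) [AddCommGroup X] [Module k X] [FiniteDimensional k X]
    (hk : ringChar k ≠ 2) {β : LinearMap.BilinForm k U}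
    (hβ : β.Nondegenerate) (hs : β.IsSymm) (d : ℕ) :
    Subrepresentation (oscillatorPair (X := X) hk hβ hs) where
  toSubmodule := codeSpan X β d
  apply_mem_toSubmodule g := by
    change codeSpan X β d ≤ (codeSpan X β d).comap (oscillatorPair hk hβ hs g)
    refine codeSpan_le fun N hN hd f hf => ?_
    rw [← hd]
    exact cssCode_le_codeSpan β hN (cssCode_invariant hk hβ hs hN g hf)

end Codes

/-! ### Weights -/

section Weights

variable {k X U : Type*} [Field k] [AddCommGroup X] [Module k X] [AddCommGroup U] [Module k U]

/-- The space of symmetric maps `X* → X`. -/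
def symmetricMaps (k X : Type*) [Field k] [AddCommGroup X] [Module k X] :
    Submodule k (Dual k X →ₗ[k] X) where
  carrier := {A | ∀ y y' : Dual k X, y (A y') = y' (A y)}
  add_mem' {A B} hA hB y y' := by simp [hA y y', hB y y']
  zero_mem' := by simp
  smul_mem' c A hA y y' := by simp [hA y y']

lemma mem_symmetricMaps {A : Dual k X →ₗ[k] X} :
    A ∈ symmetricMaps k X ↔ ∀ y y' : Dual k X, y (A y') = y' (A y) := Iff.rfl

lemma finrank_range_half_smul (h2 : (2 : k) ≠ 0) (β : LinearMap.BilinForm k U) (F : X →ₗ[k] U) :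
    finrank k (LinearMap.range ((2⁻¹ : k) • β.compl₁₂ F F)) = formRank β F := by
  rw [formRank, LinearMap.range_smul _ _ (inv_ne_zero h2)]

variable [FiniteDimensional k X]

/-- The trace pairing between symmetric maps `X* → X` and `X → X*` is nondegenerate. -/
lemma eq_zero_of_trace_eq_zero (h2 : (2 : k) ≠ 0) {C : X →ₗ[k] Dual k X}
    (hC : ∀ x x', C x x' = C x' x)
    (h : ∀ A ∈ symmetricMaps k X, LinearMap.trace k X (A ∘ₗ C) = 0) : C = 0 := by
  have h1 (x : X) : C x x = 0 := by
    have h3 : (Dual.eval k X x).smulRight x ∈ symmetricMaps k X := fun y y' => by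
      simp [mul_comm]
    have h4 : (Dual.eval k X x).smulRight x ∘ₗ C = (C x).smulRight x := by
      ext z
      simp [hC z x]
    simpa [h4] using h _ h3
  ext x x'
  have h3 := h1 (x + x')
  simp only [map_add, LinearMap.add_apply, h1, hC x' x] at h3
  refine (mul_eq_zero.1 (?_ : (2 : k) * C x x' = 0)).resolve_left h2
  linear_combination h3

variable [Finite k]

lemma finite_symmetricMaps : Finite (symmetricMaps k X) := Module.finite_of_finite k

/-- The characters of the group of symmetric maps separate the weights. -/
lemma eq_zero_of_omega_trace (h2 : (2 : k) ≠ 0) {C : X →ₗ[k] Dual k X}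
    (hC : ∀ x x', C x x' = C x' x)
    (h : ∀ A ∈ symmetricMaps k X, omega k (LinearMap.trace k X (A ∘ₗ C)) = 1) : C = 0 := by
  refine eq_zero_of_trace_eq_zero h2 hC fun A hA => ?_
  by_contra hne
  obtain ⟨a, ha⟩ := AddChar.ne_one_iff.1 (omega_ne_one k)
  refine ha ?_
  rw [← h _ ((symmetricMaps k X).smul_mem (a * (LinearMap.trace k X (A ∘ₗ C))⁻¹) hA),
    LinearMap.smul_comp, map_smul, smul_eq_mul, inv_mul_cancel_right₀ hne]

variable [FiniteDimensional k U] {hk : ringChar k ≠ 2} {β : LinearMap.BilinForm k U}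
  {hβ : β.Nondegenerate} {hs : β.IsSymm}

/-- The projection of a vector of a subrepresentation to a weight space stays in the
subrepresentation, and so does the restriction to the `F` with a given form `F^* β`. -/
lemma indicator_form_mem (K : Subrepresentation (oscillatorPair (X := X) hk hβ hs))
    {f : (X →ₗ[k] U) → ℂ} (hf : f ∈ K.toSubmodule) (F₀ : X →ₗ[k] U) :
    (fun F => open Classical in if β.compl₁₂ F F = β.compl₁₂ F₀ F₀ then f F else 0) ∈
      K.toSubmodule := by
  classical
  have h2 := Ring.two_ne_zero hk
  have := finite_symmetricMaps (k := k) (X := X)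
  have := Fintype.ofFinite (symmetricMaps k X)
  have h1 : (∑ A : symmetricMaps k X,
      omega k (-(2⁻¹ * LinearMap.trace k X (A.1 ∘ₗ β.compl₁₂ F₀ F₀))) •
        oscillatorPair hk hβ hs (unipotent A.1 (mem_symmetricMaps.1 A.2)) f) ∈ K.toSubmodule :=
    sum_mem fun A _ => K.toSubmodule.smul_mem _ (K.apply_mem_toSubmodule _ hf)
  have hc : (Fintype.card (symmetricMaps k X) : ℂ) ≠ 0 := by exact_mod_cast Fintype.card_ne_zero
  convert K.toSubmodule.smul_mem (Fintype.card (symmetricMaps k X) : ℂ)⁻¹ h1 using 1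
  ext F
  simp only [Pi.smul_apply, Finset.sum_apply, oscillatorPair_unipotent, smul_eq_mul, ← mul_assoc,
    ← AddChar.map_add_eq_mul, ← Finset.sum_mul]
  set C := β.compl₁₂ F F - β.compl₁₂ F₀ F₀ with hC
  have e (A : symmetricMaps k X) : -(2⁻¹ * LinearMap.trace k X (A.1 ∘ₗ β.compl₁₂ F₀ F₀)) +
      2⁻¹ * LinearMap.trace k X (A.1 ∘ₗ β.compl₁₂ F F) =
      ((2⁻¹ : k) • (LinearMap.trace k X ∘ₗ (LinearMap.lcomp k X C)) ∘ₗ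
        (symmetricMaps k X).subtype) A := by
    change _ = 2⁻¹ * LinearMap.trace k X (A.1 ∘ₗ C)
    rw [hC, LinearMap.comp_sub, map_sub]
    ring
  simp only [e]
  split_ifs with h
  · have h0 (A : symmetricMaps k X) : ((2⁻¹ : k) • (LinearMap.trace k X ∘ₗ
        (LinearMap.lcomp k X C)) ∘ₗ (symmetricMaps k X).subtype) A = 0 := by
      rw [← e, h, neg_add_cancel]
    simp [h0, hc]
  · rw [sum_char (omega_ne_one k)]
    · simp
    · intro h0
      refine h (sub_eq_zero.1 (eq_zero_of_trace_eq_zero h2 (fun x x' => ?_) fun A hA => ?_))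
      · simp [hs.eq (F x), hs.eq (F₀ x)]
      · have h3 : 2⁻¹ * LinearMap.trace k X (A ∘ₗ C) = 0 := LinearMap.congr_fun h0 ⟨A, hA⟩
        exact (mul_eq_zero.1 h3).resolve_left (inv_ne_zero h2)

/-- The restriction of a vector of a subrepresentation to the `F` with `F^* β` of rank `r` stays in
the subrepresentation. -/
lemma indicator_formRank_mem (K : Subrepresentation (oscillatorPair (X := X) hk hβ hs))
    {f : (X →ₗ[k] U) → ℂ} (hf : f ∈ K.toSubmodule) (r : ℕ) :
    (fun F => if formRank β F = r then f F else 0) ∈ K.toSubmodule := by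
  classical
  have : Finite (X →ₗ[k] Dual k X) := Module.finite_of_finite k
  have : Finite (X →ₗ[k] U) := Module.finite_of_finite k
  have := Fintype.ofFinite (X →ₗ[k] U)
  let S : Finset (X →ₗ[k] Dual k X) :=
    (Finset.univ.filter fun F : X →ₗ[k] U => formRank β F = r).image fun F => β.compl₁₂ F F
  have hS : (∑ B ∈ S, fun F => if β.compl₁₂ F F = B then f F else 0) ∈ K.toSubmodule := by
    refine sum_mem fun B hB => ?_
    obtain ⟨F₀, -, rfl⟩ := Finset.mem_image.1 hB
    convert indicator_form_mem K hf F₀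
  convert hS using 1
  ext F
  rw [Finset.sum_apply, Finset.sum_ite_eq]
  refine if_congr ?_ rfl rfl
  simp only [S, Finset.mem_image, Finset.mem_filter, Finset.mem_univ, true_and]
  exact ⟨fun h => ⟨F, h, rfl⟩, fun ⟨F', h, h'⟩ => by rw [← h, formRank, formRank, h']⟩

/-- The support of a vector of a subrepresentation consists of maps `F` whose form `F^* β / 2` is a
weight. -/
lemma isWeight_of_ne_zero (K : Subrepresentation (oscillatorPair (X := X) hk hβ hs))
    {f : (X →ₗ[k] U) → ℂ} (hf : f ∈ K.toSubmodule) {F : X →ₗ[k] U} (hF : f F ≠ 0) :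
    IsWeight K.toRepresentation ((2⁻¹ : k) • β.compl₁₂ F F) := by
  classical
  refine ⟨fun x x' => by simp [hs.eq (F x)], ⟨_, indicator_form_mem K hf F⟩, fun h => hF ?_,
    fun A hA => Subtype.ext (funext fun F' => ?_)⟩
  · simpa using congrFun (congrArg Subtype.val h) F
  · refine (oscillatorPair_unipotent hk hβ hs A hA _ F').trans ?_
    rw [LinearMap.comp_smul, map_smul, smul_eq_mul]
    by_cases h : β.compl₁₂ F' F' = β.compl₁₂ F F
    · rw [h]
      rfl
    · change _ * (if _ then _ else _) = _ * (if _ then _ else _)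
      rw [if_neg h, mul_zero, mul_zero]

/-- Every weight of a subrepresentation is the form `F^* β / 2` of some `F` in the support. -/
lemma exists_of_isWeight (K : Subrepresentation (oscillatorPair (X := X) hk hβ hs))
    {B : X →ₗ[k] Dual k X} (hB : IsWeight K.toRepresentation B) :
    ∃ f ∈ K.toSubmodule, ∃ F, f F ≠ 0 ∧ B = (2⁻¹ : k) • β.compl₁₂ F F := by
  obtain ⟨hsym, ⟨f, hf⟩, hne, h⟩ := hB
  obtain ⟨F, hF⟩ : ∃ F, f F ≠ 0 := by
    by_contra! h0
    exact hne (Subtype.ext (funext h0))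
  refine ⟨f, hf, F, hF, ?_⟩
  refine sub_eq_zero.1 (eq_zero_of_omega_trace (Ring.two_ne_zero hk)
    (fun x x' => by simp [hs.eq (F x), hsym x]) fun A hA => ?_)
  have h1 := congrFun (congrArg Subtype.val (h A hA)) F
  have h3 : omega k (2⁻¹ * LinearMap.trace k X (A ∘ₗ β.compl₁₂ F F)) * f F =
      omega k (LinearMap.trace k X (A ∘ₗ B)) * f F :=
    (oscillatorPair_unipotent hk hβ hs A hA f F).symm.trans h1
  have h4 := mul_right_cancel₀ hF h3
  rw [LinearMap.comp_sub, map_sub, LinearMap.comp_smul, map_smul, smul_eq_mul,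
    AddChar.map_sub_eq_div, h4, div_self]
  exact (AddChar.val_isUnit _ _).ne_zero

/-- The rank of a subrepresentation is the largest rank of `F^* β` on its support. -/
lemma repRank_spec (K : Subrepresentation (oscillatorPair (X := X) hk hβ hs)) (hK : K ≠ ⊥) :
    (∀ f ∈ K.toSubmodule, ∀ F, f F ≠ 0 → formRank β F ≤ repRank K.toRepresentation) ∧
    ∃ f ∈ K.toSubmodule, ∃ F, f F ≠ 0 ∧ formRank β F = repRank K.toRepresentation := by
  have h2 := Ring.two_ne_zero hk
  have hb : BddAbove {r | ∃ B, IsWeight K.toRepresentation B ∧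
      finrank k (LinearMap.range B) = r} :=
    ⟨finrank k X, by rintro _ ⟨B, -, rfl⟩; exact LinearMap.finrank_range_le B⟩
  constructor
  · intro f hf F hF
    exact le_csSup hb ⟨_, isWeight_of_ne_zero K hf hF, finrank_range_half_smul h2 β F⟩
  · have hne : {r | ∃ B, IsWeight K.toRepresentation B ∧
        finrank k (LinearMap.range B) = r}.Nonempty := by
      obtain ⟨f, hf, hf0⟩ : ∃ f ∈ K.toSubmodule, f ≠ 0 := by
        refine Submodule.exists_mem_ne_zero_of_ne_bot fun h => hK ?_
        exact Subrepresentation.toSubmodule_injective h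
      obtain ⟨F, hF⟩ := Function.ne_iff.1 hf0
      exact ⟨_, _, isWeight_of_ne_zero K hf hF, rfl⟩
    obtain ⟨B, hB, hr⟩ := Nat.sSup_mem hne hb
    obtain ⟨f, hf, F, hF, rfl⟩ := exists_of_isWeight K hB
    exact ⟨f, hf, F, hF, by rw [← finrank_range_half_smul h2, hr]; rfl⟩

end Weights

/-! ### Maps with the same range -/

section Moves

variable {k X U : Type*} [Field k] [AddCommGroup X] [Module k X] [AddCommGroup U] [Module k U]

lemma exists_dual_eq_one {u : U} (hu : u ≠ 0) : ∃ η : Dual k U, η u = 1 := by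
  obtain ⟨η, hη⟩ : ∃ η : Dual k U, η u ≠ 0 := by
    by_contra! h
    exact hu ((Module.forall_dual_apply_eq_zero_iff k u).1 h)
  exact ⟨(η u)⁻¹ • η, inv_mul_cancel₀ hη⟩

lemma range_add_smulRight {F : X →ₗ[k] U} {x : X} {ξ : Dual k X} {s : U} (hF : F x = 0)
    (h : ξ x = 1) (hs : s ∈ LinearMap.range F) :
    LinearMap.range (F + ξ.smulRight s) = LinearMap.range F := by
  refine le_antisymm ?_ ?_
  · rintro _ ⟨z, rfl⟩
    exact add_mem ⟨z, rfl⟩ (Submodule.smul_mem _ _ hs)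
  · rintro _ ⟨z, rfl⟩
    exact ⟨z - ξ z • x, by simp [hF, h]⟩

/-- Two maps with the same range `P`, not injective, can be joined by moves that change a map
`F` with range `P` by `ξ ⊗ s`, where `ξ` does not vanish on the kernel of `F`; here `s` need only
run through any subspace that contains the values of the difference. -/
lemma eq_of_moves [FiniteDimensional k X] [FiniteDimensional k U] {T : Type*} {f : (X →ₗ[k] U) → T}
    {P N : Submodule k U} (hNP : N ≤ P) (hP : finrank k P < finrank k X)
    (hf : ∀ (F : X →ₗ[k] U) (x : X) (ξ : Dual k X), ∀ s ∈ N, LinearMap.range F = P → F x = 0 →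
      ξ x = 1 → f (F + ξ.smulRight s) = f F)
    {F F' : X →ₗ[k] U} (hF : LinearMap.range F = P) (hF' : LinearMap.range F' = P)
    (hFF' : LinearMap.range (F' - F) ≤ N) : f F = f F' := by
  -- Induction on the rank of the difference.
  induction hn : finrank k (LinearMap.range (F' - F)) using Nat.strong_induction_on
    generalizing F F' with
  | _ n ih =>
  -- If the difference does not vanish on the kernel of `F`, a single move lowers its rank.
  have key : ∀ {F F' : X →ₗ[k] U}, LinearMap.range F = P → LinearMap.range F' = P →
      LinearMap.range (F' - F) ≤ N → finrank k (LinearMap.range (F' - F)) ≤ n →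
      ∀ x, F x = 0 → (F' - F) x ≠ 0 → f F = f F' := by
    intro F F' hF hF' hFF' hn x hx hne
    set G := F' - F with hG
    obtain ⟨η, hη⟩ := exists_dual_eq_one (k := k) hne
    have hGx : G x ∈ N := hFF' ⟨x, rfl⟩
    have e : F' - (F + (η ∘ₗ G).smulRight (G x)) = G - (η ∘ₗ G).smulRight (G x) := by
      rw [hG]; abel
    have hle : LinearMap.range (G - (η ∘ₗ G).smulRight (G x)) ≤ LinearMap.range G := by
      rintro _ ⟨z, rfl⟩
      exact sub_mem ⟨z, rfl⟩ (Submodule.smul_mem _ _ ⟨x, rfl⟩)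
    have hlt : LinearMap.range (G - (η ∘ₗ G).smulRight (G x)) < LinearMap.range G := by
      refine lt_of_le_of_ne hle fun h => ?_
      have h1 : G x ∈ LinearMap.range (G - (η ∘ₗ G).smulRight (G x)) := h ▸ ⟨x, rfl⟩
      obtain ⟨z, hz⟩ := h1
      have h2 := congrArg η hz
      simp [hη] at h2
    rw [← hf F x (η ∘ₗ G) (G x) hGx hF hx hη]
    refine ih _ (lt_of_lt_of_le (Submodule.finrank_lt_finrank_of_lt hlt) hn) ?_ hF' ?_ ?_
    · rw [range_add_smulRight hx hη (hF ▸ hNP hGx), hF]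
    · rw [e]
      exact hle.trans hFF'
    · rw [e]
  obtain ⟨x, hx, hx0⟩ : ∃ x, F x = 0 ∧ x ≠ 0 := by
    have h1 := LinearMap.finrank_range_add_finrank_ker F
    rw [hF] at h1
    obtain ⟨x, hx, hx0⟩ := Submodule.exists_mem_ne_zero_of_ne_bot
      (Submodule.one_le_finrank_iff.1 (show 1 ≤ finrank k (LinearMap.ker F) by omega))
    exact ⟨x, hx, hx0⟩
  by_cases hxF' : (F' - F) x = 0
  · by_cases hG : F' - F = 0
    · rw [sub_eq_zero.1 hG]
    -- Otherwise a move of `F` that does not raise the rank makes the difference nonzero on the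
    -- kernel of `F'`.
    obtain ⟨z, hz⟩ : ∃ z, (F' - F) z ≠ 0 := by
      by_contra! h
      exact hG (LinearMap.ext h)
    obtain ⟨η, hη⟩ := exists_dual_eq_one (k := k) hz
    obtain ⟨ζ, hζ⟩ := exists_dual_eq_one (k := k) hx0
    set G := F' - F with hG
    have hGz : G z ∈ N := hFF' ⟨z, rfl⟩
    let ξ : Dual k X := ζ + (1 - ζ z) • (η ∘ₗ G)
    have hξx : ξ x = 1 := by simp [ξ, hζ, hxF']
    have hF'x : F' x = 0 := by
      rw [hG, LinearMap.sub_apply, hx, sub_zero] at hxF'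
      exact hxF'
    have e : F + ξ.smulRight (G z) - F' = ξ.smulRight (G z) - G := by
      rw [hG]; abel
    have hle : LinearMap.range (ξ.smulRight (G z) - G) ≤ LinearMap.range G := by
      rintro _ ⟨w, rfl⟩
      exact sub_mem (Submodule.smul_mem _ _ ⟨z, rfl⟩) ⟨w, rfl⟩
    rw [← hf F x ξ (G z) hGz hF hx hξx]
    refine (key hF' ?_ ?_ ?_ x hF'x ?_).symm
    · rw [range_add_smulRight hx hξx (hF ▸ hNP hGz), hF]
    · rw [e]
      exact hle.trans hFF'
    · rw [e, ← hn]
      exact Submodule.finrank_mono hle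
    · rw [e]
      simpa [hξx, hxF'] using hz
  · exact key hF hF' hFF' hn.le x hx hxF'

end Moves

/-! ### Functions with prescribed support -/

section CosetExtension

variable {k X U : Type*} [Field k] [AddCommGroup X] [Module k X] [AddCommGroup U] [Module k U]
  {β : LinearMap.BilinForm k U} {f : (X →ₗ[k] U) → ℂ}

/-- The function that takes on a coset of `Hom(X, N)` the value of `f` at the elements with range
`N^⊥`, and `0` if there is no such element. -/
noncomputable def cosetExtension (β : LinearMap.BilinForm k U) (N : Submodule k U)
    (f : (X →ₗ[k] U) → ℂ) (F : X →ₗ[k] U) : ℂ :=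
  open Classical in
  if h : ∃ F', LinearMap.range F' = β.orthogonal N ∧ LinearMap.range (F' - F) ≤ N then
    f h.choose else 0

lemma exists_of_cosetExtension_ne_zero {N : Submodule k U} {F : X →ₗ[k] U}
    (h : cosetExtension β N f F ≠ 0) :
    ∃ F', LinearMap.range F' = β.orthogonal N ∧ LinearMap.range (F' - F) ≤ N := by
  by_contra hne
  exact h (dif_neg hne)

lemma range_le_of_cosetExtension_ne_zero {N : Submodule k U} (hN : N ≤ β.orthogonal N)
    {F : X →ₗ[k] U} (h : cosetExtension β N f F ≠ 0) : LinearMap.range F ≤ β.orthogonal N := by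
  obtain ⟨F', hF', hFF'⟩ := exists_of_cosetExtension_ne_zero h
  rintro _ ⟨z, rfl⟩
  have := sub_mem (hF' ▸ ⟨z, rfl⟩ : F' z ∈ β.orthogonal N) (hN (hFF' ⟨z, rfl⟩))
  simpa using this

/-- The functions supported on the maps `F` with `F^* β` of rank at most `r`. -/
def supportedRankLE (X : Type*) [AddCommGroup X] [Module k X] (β : LinearMap.BilinForm k U)
    (r : ℕ) : Submodule ℂ ((X →ₗ[k] U) → ℂ) where
  carrier := {f | ∀ F, f F ≠ 0 → formRank β F ≤ r}
  add_mem' {f g} hf hg F hF := by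
    by_cases h : f F = 0
    · exact hg F fun h' => hF (by simp [h, h'])
    · exact hf F h
  zero_mem' F hF := absurd rfl hF
  smul_mem' c f hf F hF := hf F fun h => hF (by simp [h])

variable [FiniteDimensional k X] [FiniteDimensional k U]

lemma formRank_add_le_of_mem_codeSpan (hβ : β.Nondegenerate) (hs : β.IsSymm) {d : ℕ}
    (hf : f ∈ codeSpan X β d) {F : X →ₗ[k] U} (hF : f F ≠ 0) :
    formRank β F + 2 * d ≤ finrank k U := by
  by_contra hlt
  have h : codeSpan X β d ≤ LinearMap.ker (LinearMap.proj (R := ℂ) (φ := fun _ => ℂ) F) := by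
    refine codeSpan_le fun N hN hd g hg => ?_
    by_contra hne
    exact hlt (hd ▸ formRank_add_le hβ hs hN (hg.1 F hne))
  exact hF (h hf)

end CosetExtension

/-! ### Support and Fourier transform -/

section Support

variable {k X U : Type*} [Field k] [Finite k] [AddCommGroup X] [Module k X]
  [FiniteDimensional k X] [AddCommGroup U] [Module k U] [FiniteDimensional k U]
  {hk : ringChar k ≠ 2} {β : LinearMap.BilinForm k U} {hβ : β.Nondegenerate} {hs : β.IsSymm}
  {K : Subrepresentation (oscillatorPair (X := X) hk hβ hs)} {r : ℕ} {f : (X →ₗ[k] U) → ℂ}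

/-- If all of `K` is supported on forms of rank at most `r`, and `F^* β` has rank `r`, then the
Fourier transform of `f ∈ K` along `F + ξ ⊗ u` is supported on those `v` for which the form of
`F + ξ ⊗ v` has rank at most `r`. So for such `v` the vectors orthogonal to the kernel of `ξ` lie in
the radical of that form. -/
lemma radical_of_fourier_ne_zero [Fintype U]
    (hK : ∀ f ∈ K.toSubmodule, ∀ F, f F ≠ 0 → formRank β F ≤ r) (hf : f ∈ K.toSubmodule)
    {F : X →ₗ[k] U} (hF : formRank β F = r) {x : X} {ξ : Dual k X} (hx : F x = 0) (h : ξ x = 1)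
    {v : U} (hv : ∑ u, omega k (β u v) * f (F + ξ.smulRight u) ≠ 0) {z : X}
    (hz : ∀ z', β ((F + ξ.smulRight v) z) (F z') = 0) (z' : X) :
    β ((F + ξ.smulRight v) z) ((F + ξ.smulRight v) z') = 0 := by
  rw [← partialFourier_slice (omega k) β h f hx] at hv
  have h1 := hK _ (partialFourier_mem K h hf) _ hv
  have h2 : (F + ξ.smulRight v) ∘ₗ (LinearMap.id - ξ.smulRight x) = F := by
    ext z
    simp [hx, h]
  refine mem_radical_of_formRank_le (π := LinearMap.id - ξ.smulRight x) ?_ (fun z' => ?_) z'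
  · rwa [h2, hF]
  · exact (congrArg _ (LinearMap.congr_fun h2 z')).trans (hz z')

lemma fourier_support_le [Fintype U]
    (hK : ∀ f ∈ K.toSubmodule, ∀ F, f F ≠ 0 → formRank β F ≤ r) (hf : f ∈ K.toSubmodule)
    {F : X →ₗ[k] U} (hF : formRank β F = r) {x : X} {ξ : Dual k X} (hx : F x = 0) (h : ξ x = 1)
    {v : U} (hv : ∑ u, omega k (β u v) * f (F + ξ.smulRight u) ≠ 0) {s : U}
    (hs' : s ∈ LinearMap.range F ⊓ β.orthogonal (LinearMap.range F)) : β s v = 0 := by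
  obtain ⟨⟨z, rfl⟩, h2⟩ := hs'
  have h3 : (F + ξ.smulRight v) (z - ξ z • x) = F z := by simp [hx, h]
  have h4 := radical_of_fourier_ne_zero hK hf hF hx h hv (z := z - ξ z • x) (fun z' => ?_) x
  · rw [h3] at h4
    simpa [hx, h] using h4
  · rw [h3, hs.eq]
    exact LinearMap.BilinForm.mem_orthogonal_iff.1 h2 _ ⟨z', rfl⟩

/-- If `K` is supported on forms of rank at most `r < dim U`, then every `f ∈ K` that does not
vanish on the forms of rank `r` is nonzero at an `F` with `F^* β` of rank `r` and coisotropic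
range. -/
lemma exists_coisotropic_range (htn : finrank k U ≤ finrank k X)
    (hK : ∀ f ∈ K.toSubmodule, ∀ F, f F ≠ 0 → formRank β F ≤ r) (hr : r < finrank k U)
    (hf : f ∈ K.toSubmodule) (hF : ∃ F, f F ≠ 0 ∧ formRank β F = r) :
    ∃ F, f F ≠ 0 ∧ formRank β F = r ∧ β.orthogonal (LinearMap.range F) ≤ LinearMap.range F := by
  have : Finite U := Module.finite_of_finite k
  have := Fintype.ofFinite U
  have : Finite (X →ₗ[k] U) := Module.finite_of_finite k
  have h2 := Ring.two_ne_zero hk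
  -- Among the `F` in question, one whose range has the largest dimension will do.
  obtain ⟨F, ⟨hF0, hFr⟩, hmax⟩ := Set.exists_max_image {F | f F ≠ 0 ∧ formRank β F = r}
    (fun F => finrank k (LinearMap.range F)) (Set.toFinite _) hF
  refine ⟨F, hF0, hFr, ?_⟩
  obtain ⟨x, hx, hx0⟩ : ∃ x, F x = 0 ∧ x ≠ 0 := by
    by_contra! h
    have h1 : finrank k (LinearMap.range F) = finrank k X :=
      LinearMap.finrank_range_of_inj ((injective_iff_map_eq_zero F).2 h)
    have h3 : LinearMap.range F = ⊤ := Submodule.eq_top_of_finrank_eq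
      (le_antisymm (Submodule.finrank_le _) (h1 ▸ htn))
    have h4 := formRank_add_of_range_eq hβ hs (N := ⊥) bot_le (F := F) (by rw [h3]; simp)
    rw [finrank_bot] at h4
    omega
  obtain ⟨ξ, hξ⟩ := exists_dual_eq_one (k := k) hx0
  set P := LinearMap.range F with hP
  -- By maximality, the function `u ↦ f (F + ξ ⊗ u)` is supported on the range of `F`.
  have hsupp (u : U) (hu : f (F + ξ.smulRight u) ≠ 0) : u ∈ P := by
    have e : (F + ξ.smulRight u) ∘ₗ (LinearMap.id - ξ.smulRight x) = F := by
      ext z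
      simp [hx, hξ]
    have h1 := formRank_comp_le β (F + ξ.smulRight u) (LinearMap.id - ξ.smulRight x)
    rw [e, hFr] at h1
    have h3 := hmax _ ⟨hu, le_antisymm (hK f hf _ hu) h1⟩
    have h4 : P ≤ LinearMap.range (F + ξ.smulRight u) := by
      rw [hP]
      conv_lhs => rw [← e]
      exact LinearMap.range_comp_le_range _ _
    rw [Submodule.eq_of_le_of_finrank_le h4 h3]
    exact ⟨x, by simp [hx, hξ]⟩
  -- So its Fourier transform is invariant under the orthogonal complement.
  have hinv (v w : U) (hw : w ∈ β.orthogonal P) :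
      ∑ u, omega k (β u (v + w)) * f (F + ξ.smulRight u) =
        ∑ u, omega k (β u v) * f (F + ξ.smulRight u) := by
    refine Finset.sum_congr rfl fun u _ => ?_
    by_cases hu : f (F + ξ.smulRight u) = 0
    · rw [hu, mul_zero, mul_zero]
    · rw [map_add, LinearMap.BilinForm.mem_orthogonal_iff.1 hw u (hsupp u hu), add_zero]
  obtain ⟨v, hv⟩ := exists_fourier_ne_zero hβ (omega_ne_one k)
    (φ := fun u => f (F + ξ.smulRight u)) (u := 0) (by simpa using hF0)
  have hv1 : v ∈ P ⊔ β.orthogonal P := by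
    refine orthogonal_inf_orthogonal_le hβ hs P ?_
    rw [LinearMap.BilinForm.mem_orthogonal_iff]
    exact fun s hs' => fourier_support_le hK hf hFr hx hξ hv hs'
  obtain ⟨p, ⟨z, rfl⟩, p', hp', rfl⟩ := Submodule.mem_sup.1 hv1
  have h3 : β.orthogonal P ≤ β.orthogonal (β.orthogonal P) := by
    refine le_orthogonal_of_forall_self hs h2 fun w hw => ?_
    have h5 : ∑ u, omega k (β u (F z + w)) * f (F + ξ.smulRight u) ≠ 0 := by
      rw [hinv _ _ hw]
      rwa [hinv _ _ hp'] at hv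
    -- `w` is a value of `F + ξ ⊗ (F z + w)` orthogonal to the range of `F`.
    have h6 : (F + ξ.smulRight (F z + w)) (x - (z - ξ z • x)) = w := by simp [hx, hξ]
    have h7 := radical_of_fourier_ne_zero hK hf hFr hx hξ h5 (z := x - (z - ξ z • x))
      (fun z' => by
        rw [h6, hs.eq]
        exact LinearMap.BilinForm.mem_orthogonal_iff.1 hw _ ⟨z', rfl⟩) (x - (z - ξ z • x))
    rwa [h6] at h7
  rwa [LinearMap.BilinForm.orthogonal_orthogonal hβ hs.isRefl] at h3

/-- On the maps with range `N^⊥`, the elements of `K` are constant on the cosets of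
`Hom(X, N)`. -/
lemma eq_of_range_eq (htn : finrank k U ≤ finrank k X)
    (hK : ∀ f ∈ K.toSubmodule, ∀ F, f F ≠ 0 → formRank β F ≤ r) (hf : f ∈ K.toSubmodule)
    {N : Submodule k U} (hN : N ≤ β.orthogonal N) (hr : r < finrank k U)
    (hd : r + 2 * finrank k N = finrank k U) {F F' : X →ₗ[k] U}
    (hF : LinearMap.range F = β.orthogonal N) (hF' : LinearMap.range F' = β.orthogonal N)
    (hFF' : LinearMap.range (F' - F) ≤ N) : f F = f F' := by
  have : Finite U := Module.finite_of_finite k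
  have := Fintype.ofFinite U
  refine eq_of_moves hN ?_ ?_ hF hF' hFF'
  · rw [LinearMap.BilinForm.finrank_orthogonal hβ]
    omega
  · intro F x ξ s hsN hF hx hξ
    have h1 := formRank_add_of_range_eq hβ hs hN hF
    have h2 := eq_of_fourier_support (ψ := omega k) hβ (omega_ne_one k)
      (φ := fun u => f (F + ξ.smulRight u)) (s := s) (fun v hv =>
        fourier_support_le hK hf (by omega) hx hξ hv ⟨hF ▸ hN hsN, ?_⟩) 0
    · simpa using h2
    · rw [hF, LinearMap.BilinForm.orthogonal_orthogonal hβ hs.isRefl]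
      exact hsN

lemma cosetExtension_eq (htn : finrank k U ≤ finrank k X)
    (hK : ∀ f ∈ K.toSubmodule, ∀ F, f F ≠ 0 → formRank β F ≤ r) (hf : f ∈ K.toSubmodule)
    {N : Submodule k U} (hN : N ≤ β.orthogonal N) (hr : r < finrank k U)
    (hd : r + 2 * finrank k N = finrank k U) {F F' : X →ₗ[k] U}
    (hF' : LinearMap.range F' = β.orthogonal N) (hFF' : LinearMap.range (F' - F) ≤ N) :
    cosetExtension β N f F = f F' := by
  have h : ∃ F', LinearMap.range F' = β.orthogonal N ∧ LinearMap.range (F' - F) ≤ N :=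
    ⟨F', hF', hFF'⟩
  rw [cosetExtension, dif_pos h]
  refine eq_of_range_eq htn hK hf hN hr hd h.choose_spec.1 hF' ?_
  rintro _ ⟨z, rfl⟩
  have := N.sub_mem (hFF' ⟨z, rfl⟩) (h.choose_spec.2 ⟨z, rfl⟩)
  simpa using this

lemma cosetExtension_mem_cssCode (htn : finrank k U ≤ finrank k X)
    (hK : ∀ f ∈ K.toSubmodule, ∀ F, f F ≠ 0 → formRank β F ≤ r) (hf : f ∈ K.toSubmodule)
    {N : Submodule k U} (hN : N ≤ β.orthogonal N) (hr : r < finrank k U)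
    (hd : r + 2 * finrank k N = finrank k U) : cosetExtension β N f ∈ cssCode X β N := by
  have key {F F' : X →ₗ[k] U} (h : LinearMap.range (F - F') ≤ N)
      (hne : cosetExtension β N f F ≠ 0) : cosetExtension β N f F = cosetExtension β N f F' := by
    obtain ⟨G, hG, hGF⟩ := exists_of_cosetExtension_ne_zero hne
    rw [cosetExtension_eq htn hK hf hN hr hd hG hGF, cosetExtension_eq htn hK hf hN hr hd hG]
    rintro _ ⟨z, rfl⟩
    have := N.add_mem (hGF ⟨z, rfl⟩) (h ⟨z, rfl⟩)
    simpa using this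
  refine ⟨fun F hF => range_le_of_cosetExtension_ne_zero hN hF, fun F F' h => ?_⟩
  by_cases h1 : cosetExtension β N f F = 0
  · by_cases h3 : cosetExtension β N f F' = 0
    · rw [h1, h3]
    · refine (key (fun u hu => h ?_) h3).symm
      obtain ⟨z, rfl⟩ := hu
      exact ⟨-z, by rw [map_neg, ← LinearMap.neg_apply, neg_sub]⟩
  · exact key h h1

/-- On the forms of the maximal rank `r`, the elements of `K` agree with elements of the span of
the codes. -/
lemma exists_mem_codeSpan_eq (htn : finrank k U ≤ finrank k X)
    (hK : ∀ f ∈ K.toSubmodule, ∀ F, f F ≠ 0 → formRank β F ≤ r) (hf : f ∈ K.toSubmodule)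
    {d : ℕ} (hr : r < finrank k U) (hd : r + 2 * d = finrank k U)
    (hC : codeSpan X β d ≤ K.toSubmodule) :
    ∃ s ∈ codeSpan X β d, ∀ F, formRank β F = r → f F = s F := by
  classical
  have : Finite U := Module.finite_of_finite k
  have : Finite (Submodule k U) := Finite.of_injective _ SetLike.coe_injective
  have := Fintype.ofFinite (Submodule k U)
  let S : Finset (Submodule k U) := Finset.univ.filter fun N => N ≤ β.orthogonal N ∧ finrank k N = d
  have hmem : ∑ N ∈ S, cosetExtension β N f ∈ codeSpan X β d := by
    refine sum_mem fun N hN => ?_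
    obtain ⟨-, hN', rfl⟩ := Finset.mem_filter.1 hN
    exact cssCode_le_codeSpan β hN' (cosetExtension_mem_cssCode htn hK hf hN' hr hd)
  refine ⟨_, hmem, ?_⟩
  by_contra! hcon
  obtain ⟨F₁, hF₁, hne⟩ := hcon
  obtain ⟨F, hF0, hFr, hF⟩ := exists_coisotropic_range htn hK hr
    (K.toSubmodule.sub_mem hf (hC hmem)) ⟨F₁, sub_ne_zero.2 hne, hF₁⟩
  set N := β.orthogonal (LinearMap.range F) with hN
  have hNF : LinearMap.range F = β.orthogonal N :=
    (LinearMap.BilinForm.orthogonal_orthogonal hβ hs.isRefl _).symm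
  have hNi : N ≤ β.orthogonal N := hNF ▸ hF
  have h1 := formRank_add_of_range_eq hβ hs hNi hNF
  have hNd : finrank k N = d := by omega
  refine hF0 ?_
  rw [Pi.sub_apply, Finset.sum_apply, Finset.sum_eq_single N,
    cosetExtension_eq htn hK hf hNi hr (by omega) hNF (by simp), sub_self]
  · intro M hM hMN
    obtain ⟨-, hMi, hMd⟩ := Finset.mem_filter.1 hM
    by_contra hne
    have h3 := LinearMap.BilinForm.orthogonal_le (B := β)
      (range_le_of_cosetExtension_ne_zero hMi hne)
    rw [LinearMap.BilinForm.orthogonal_orthogonal hβ hs.isRefl] at h3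
    exact hMN (Submodule.eq_of_le_of_finrank_le h3 (by omega))
  · intro h
    exact absurd (Finset.mem_filter.2 ⟨Finset.mem_univ _, hNi, hNd⟩) h

/-- A subrepresentation that is supported on forms of rank at most `r` is contained in the span of
the codes of dimension at least `(dim U - r) / 2`. -/
theorem le_codeSpan (htn : finrank k U ≤ finrank k X) (hr : r ≤ finrank k U)
    (K : Subrepresentation (oscillatorPair (X := X) hk hβ hs))
    (hK : K.toSubmodule ≤ supportedRankLE X β r) :
    K.toSubmodule ≤ codeSpan X β ((finrank k U - r + 1) / 2) := by
  induction r using Nat.strong_induction_on generalizing K with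
  | _ r ih =>
  obtain hr' | hr' := hr.eq_or_lt
  · rw [← hr', Nat.sub_self, Nat.div_eq_of_lt (by norm_num), codeSpan_zero]
    exact le_top
  set d := (finrank k U - r + 1) / 2 with hd
  set S := codeSubrep X hk hβ hs d with hS
  have hKS : (K ⊔ S).toSubmodule ≤ supportedRankLE X β r := by
    refine sup_le hK fun f hf F hF => ?_
    have := formRank_add_le_of_mem_codeSpan hβ hs hf hF
    omega
  have : Finite X := Module.finite_of_finite k
  have : Finite (Dual k X) := finite_dual
  have : Finite (Sp k X) :=
    Finite.of_injective (fun g v => g.1 v) fun g h e => Subtype.ext (LinearEquiv.ext (congrFun e))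
  -- By complete reducibility it suffices to treat a complement of `S` in `K ⊔ S`.
  obtain ⟨C, hC⟩ := exists_isCompl S
  have hlt : ∀ f ∈ (K ⊔ S) ⊓ C, ∀ F, f F ≠ 0 → formRank β F < r := by
    intro f hf F hF
    refine lt_of_le_of_ne (hKS hf.1 F hF) fun hFr => ?_
    obtain ⟨F₀, -, hF₀, hc⟩ := exists_coisotropic_range htn hKS hr' hf.1 ⟨F, hF, hFr⟩
    have h1 := formRank_add_of_range_eq hβ hs (F := F₀) (N := β.orthogonal (LinearMap.range F₀))
      (by rwa [LinearMap.BilinForm.orthogonal_orthogonal hβ hs.isRefl])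
      (LinearMap.BilinForm.orthogonal_orthogonal hβ hs.isRefl _).symm
    obtain ⟨s, hs', hfs⟩ := exists_mem_codeSpan_eq htn hKS hf.1 (d := d) hr' (by omega) le_sup_right
    -- The part of `f` of rank `r` lies in both `S` and its complement.
    have h3 := indicator_formRank_mem C hf.2 r
    have h4 := indicator_formRank_mem S hs' r
    have h5 : (fun F => if formRank β F = r then f F else 0) =
        fun F => if formRank β F = r then s F else 0 := by
      ext F
      split_ifs with h
      · exact hfs F h
      · rfl
    have h6 : (fun F => if formRank β F = r then f F else 0) ∈ (S ⊓ C).toSubmodule :=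
      ⟨h5 ▸ h4, h3⟩
    rw [hC.inf_eq_bot] at h6
    have h7 := congrFun ((Submodule.mem_bot ℂ).1 h6) F
    rw [if_pos hFr] at h7
    exact hF h7
  have hle : ((K ⊔ S) ⊓ C).toSubmodule ≤ codeSpan X β d := by
    obtain rfl | hr0 := Nat.eq_zero_or_pos r
    · intro f hf
      have : f = 0 := by
        by_contra hne
        obtain ⟨F, hF⟩ := Function.ne_iff.1 hne
        exact absurd (hlt f hf F hF) (Nat.not_lt_zero _)
      rw [this]
      exact zero_mem _
    · exact (ih (r - 1) (by omega) (by omega) _ fun f hf F hF => Nat.le_sub_one_of_lt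
        (hlt f hf F hF)).trans (codeSpan_anti β (by omega))
  intro f hf
  have h1 : f ∈ (S ⊔ C).toSubmodule := by
    rw [hC.sup_eq_top]
    exact Submodule.mem_top
  obtain ⟨s, hs', c, hc, rfl⟩ := Submodule.mem_sup.1 h1
  refine add_mem hs' (hle ⟨?_, hc⟩)
  have h2 := sub_mem (Submodule.mem_sup_left hf : s + c ∈ K.toSubmodule ⊔ S.toSubmodule)
    (Submodule.mem_sup_right hs')
  rwa [add_sub_cancel_left] at h2

end Support

end Oscillator

theorem theorem2 {k X U : Type*} [Field k] [Finite k] (hk : ringChar k ≠ 2)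
    [AddCommGroup X] [Module k X] [FiniteDimensional k X]
    [AddCommGroup U] [Module k U] [FiniteDimensional k U]
    (β : LinearMap.BilinForm k U) (hβ : β.Nondegenerate) (hs : β.IsSymm)
    (htn : Module.finrank k U ≤ Module.finrank k X)
    (K : Subrepresentation (Oscillator.oscillatorPair (X := X) hk hβ hs)) (hK : K ≠ ⊥)
    (r : ℕ) (hr : Oscillator.repRank K.toRepresentation = r) :
    r ≤ Module.finrank k U ∧ Even (Module.finrank k U - r) ∧
      K.toSubmodule ≤ ⨆ (N : Submodule k U) (_ : N ≤ β.orthogonal N)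
        (_ : Module.finrank k N = (Module.finrank k U - r) / 2), Oscillator.cssCode X β N := by
  obtain ⟨hle, f, hf, F, hF, hFr⟩ := Oscillator.repRank_spec K hK
  rw [hr] at hle hFr
  have h1 : r ≤ finrank k U := by
    have := Oscillator.formRank_add hs F
    have := Submodule.finrank_le (LinearMap.range F)
    omega
  have h2 := Oscillator.le_codeSpan htn h1 K hle
  -- At the maximal rank the bound on the rank in the codes is attained, which gives the parity.
  have h3 := Oscillator.formRank_add_le_of_mem_codeSpan hβ hs (h2 hf) hF
  have h4 : (finrank k U - r + 1) / 2 = (finrank k U - r) / 2 := by omega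
  rw [h4] at h2
  exact ⟨h1, Nat.even_iff.2 (by omega), h2⟩
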